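/- Let $A$ and $B$ be $C^*$-algebras (not necessarily unital), let $\rho : A \to B$ be an injective $*$-homomorphism, let $\mathscr{A} \subseteq A$ be a norm-dense $*$-subalgebra, and let $\delta : \mathscr{A} \to B$ be a linear map with $\delta(a_1 a_2) = \delta(a_1)\rho(a_2) + \rho(a_1)\delta(a_2)$ and $\delta(a^*) = -\delta(a)^*$ for all $a, a_1, a_2 \in \mathscr{A}$, which is closed: if $a_n \in \mathscr{A}$, $a_n \to 0$ in $A$ and $\delta(a_n) \to b$ in $B$, then $b = 0$. Let $X$ be a (right) Hilbert $C^*$-module over $A$ for which there is a sequence $(\xi_n)_{n \ge 1}$ in $X$ such that $\langle \xi_n, \xi_m\rangle \in \mathscr{A}$ for all $n, m$ and such that the set of finite sums $\sum_{n=1}^N \xi_n a_n$ with $a_n \in A$ is dense in $X$. Let $H_A$ be the standard Hilbert $C^*$-module of sequences $(a_n)_{n\ge1}$ in $A$ for which $\sum_n a_n^* a_n$ converges in norm, with $\langle (a_n), (b_n)\rangle = \sum_n a_n^* b_n$, and let $\mathscr{K}(H_A)$ be the compact operators on $H_A$, that is, the operator norm closure of the linear span of the operators $z \mapsto x\langle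 y, z\rangle$ with $x, y \in H_A$. Let $\mathscr{K}(H_A)_\delta \subseteq \mathscr{K}(H_A)$ be the completion of the $*$-algebra $M_\infty(\mathscr{A})$ of finite matrices over $\mathscr{A}$ in the norm $\|a\|_\delta = \|a\| + \|\delta(a)\|$, where $\delta(a) = (\delta(a_{ij}))$ and $\|a\|$, $\|\delta(a)\|$ are the norms of $a$ and $\delta(a)$ as operators on $H_A$ and $H_B$. In other words, $\mathscr{K}(H_A)_\delta$ consists of the operator norm limits of $\|\cdot\|_\delta$-Cauchy sequences in $M_\infty(\mathscr{A})$. Then there exist a bounded adjointable isometry $W : X \to H_A$ and a positive selfadjoint bounded operator $K : H_A \to H_A$ such that, with $P := W W^*$ the associated orthogonal projection, 1. $K P = P K$; 2. $W^* K W : X \to X$ has dense image; 3. $P K \in \mathscr{K}(H_A)$; 4. $P K^2 \in \mathscr{K}(H_A)_\delta$. -/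

import Mathlib

open Filter Topology MulOpposite
open scoped RightActions

namespace DiffAbsorption

/-! ### Right Hilbert modules

The class `CStarModule R E` has `⟪x, r • y⟫ = r * ⟪x, y⟫`.  A (right) Hilbert C*-module over `A` in
the usual sense, with `⟨x, y a⟩ = ⟨x, y⟩ a`, is therefore a complete `CStarModule Aᵐᵒᵖ E`. -/

section RightInner

variable {A E : Type*} [NonUnitalCStarAlgebra A] [PartialOrder A]
  [AddCommGroup E] [Module ℂ E] [SMul Aᵐᵒᵖ E] [Norm E] [CStarModule Aᵐᵒᵖ E]

/-- The `A`-valued inner product of a right Hilbert module over `A`: conjugate linear in the first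
variable and `A`-linear in the second one. -/
def rinner (A : Type*) {E : Type*} [Inner Aᵐᵒᵖ E] (x y : E) : A := unop (inner Aᵐᵒᵖ x y)

theorem rinner_smul_right (x y : E) (a : A) : rinner A x (y <• a) = rinner A x y * a := by
  simp [rinner]

theorem star_rinner (x y : E) : star (rinner A x y) = rinner A y x := by
  rw [rinner, ← unop_star, CStarModule.star_inner]; rfl

/-- The set `{∑_{n < N} ξ_n a_n | N ∈ ℕ, a_n ∈ A}`. -/
def rightSpan (A : Type*) {E : Type*} [AddCommGroup E] [SMul Aᵐᵒᵖ E] (ξ : ℕ → E) : Set E :=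
  {x | ∃ (N : ℕ) (a : ℕ → A), x = ∑ n ∈ Finset.range N, ξ n <• a n}

end RightInner

/-! ### The standard module -/

section StdModule

variable {A : Type*} [NonUnitalCStarAlgebra A]

section Aux

variable [PartialOrder A] [StarOrderedRing A]

theorem norm_sum_star_mul_le (s : Finset ℕ) (x y : ℕ → A) :
    ‖∑ n ∈ s, star (x n) * y n‖ ≤
      √‖∑ n ∈ s, star (x n) * x n‖ * √‖∑ n ∈ s, star (y n) * y n‖ := by
  have h := CStarModule.norm_inner_le (A := A) (WithCStarModule A ((_i : s) → A))
    (x := (WithCStarModule.equiv A ((_i : s) → A)).symm fun i => star (y i))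
    (y := (WithCStarModule.equiv A ((_i : s) → A)).symm fun i => star (x i))
  simp only [WithCStarModule.pi_inner, WithCStarModule.pi_norm, WithCStarModule.inner_def,
    WithCStarModule.equiv_symm_pi_apply, star_star] at h
  rw [Finset.sum_coe_sort s (fun n => star (x n) * y n),
    Finset.sum_coe_sort s (fun n => star (x n) * x n),
    Finset.sum_coe_sort s (fun n => star (y n) * y n)] at h
  linarith

/-- For the series `∑ a_n^* a_n`, convergence of the partial sums is summability. -/
theorem summable_iff_cauchySeq (x : ℕ → A) :
    Summable (fun n => star (x n) * x n) ↔
      CauchySeq (fun N => ∑ n ∈ Finset.range N, star (x n) * x n) := by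
  refine ⟨fun h => h.hasSum.tendsto_sum_nat.cauchySeq, fun h => ?_⟩
  rw [summable_iff_vanishing_norm]
  intro ε hε
  obtain ⟨N, hN⟩ := Metric.cauchySeq_iff'.1 h ε hε
  refine ⟨Finset.range N, fun t ht => ?_⟩
  obtain ⟨M, hM⟩ := t.exists_nat_subset_range
  have hsub : t ⊆ Finset.Ico N (max M N) := by
    intro i hi
    have h1 := Finset.mem_range.1 (hM hi)
    have h2 : ¬ i < N := fun h => Finset.disjoint_left.1 ht hi (Finset.mem_range.2 h)
    rw [Finset.mem_Ico]
    exact ⟨by omega, lt_of_lt_of_le h1 (le_max_left _ _)⟩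
  have h3 := hN (max M N) (le_max_right _ _)
  rw [dist_eq_norm, ← Finset.sum_Ico_eq_sub _ (le_max_right M N)] at h3
  refine lt_of_le_of_lt ?_ h3
  exact CStarAlgebra.norm_le_norm_of_nonneg_of_le
    (Finset.sum_nonneg fun i _ => star_mul_self_nonneg _)
    (Finset.sum_le_sum_of_subset_of_nonneg hsub fun i _ _ => star_mul_self_nonneg _)

theorem summable_star_mul {x y : ℕ → A} (hx : Summable fun n => star (x n) * x n)
    (hy : Summable fun n => star (y n) * y n) : Summable fun n => star (x n) * y n := by
  rw [summable_iff_vanishing_norm] at hx hy ⊢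
  intro ε hε
  obtain ⟨s, hs⟩ := hx ε hε
  obtain ⟨t, ht⟩ := hy ε hε
  refine ⟨s ∪ t, fun u hu => ?_⟩
  rw [Finset.disjoint_union_right] at hu
  refine (norm_sum_star_mul_le u x y).trans_lt ?_
  calc _ < √ε * √ε := by
        have h1 := Real.sqrt_lt_sqrt (norm_nonneg _) (hs u hu.1)
        have h2 := Real.sqrt_lt_sqrt (norm_nonneg _) (ht u hu.2)
        exact mul_lt_mul'' h1 h2 (Real.sqrt_nonneg _) (Real.sqrt_nonneg _)
    _ = ε := Real.mul_self_sqrt hε.le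

end Aux

variable (A) in
/-- The sequences `(a_n)` in `A` for which `∑ a_n^* a_n` converges in norm. -/
def stdSubmodule [PartialOrder A] [StarOrderedRing A] : Submodule ℂ (ℕ → A) where
  carrier := {x | Summable fun n => star (x n) * x n}
  zero_mem' := by simp
  add_mem' := by
    intro x y hx hy
    have := ((hx.add (summable_star_mul hx hy)).add (summable_star_mul hy hx)).add hy
    refine this.congr fun n => ?_
    simp [add_mul, mul_add]; abel
  smul_mem' := by
    intro c x hx
    refine (Summable.const_smul (star c * c) hx).congr fun n => ?_
    simp [smul_mul_smul_comm]

variable (A) in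
/-- The standard module `H_A`. -/
def StdModule [PartialOrder A] [StarOrderedRing A] : Type _ := stdSubmodule A

namespace StdModule

variable [PartialOrder A] [StarOrderedRing A]

noncomputable instance : AddCommGroup (StdModule A) :=
  inferInstanceAs (AddCommGroup (stdSubmodule A))

noncomputable instance : Module ℂ (StdModule A) := inferInstanceAs (Module ℂ (stdSubmodule A))

instance : CoeFun (StdModule A) fun _ => ℕ → A := ⟨fun x => x.1⟩

theorem summable (x y : StdModule A) : Summable fun n => star (x n) * y n :=
  summable_star_mul x.2 y.2

@[ext] theorem ext {x y : StdModule A} (h : ∀ n, x n = y n) : x = y := Subtype.ext (funext h)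

@[simp] theorem add_apply (x y : StdModule A) (n : ℕ) : (x + y) n = x n + y n := rfl
@[simp] theorem zero_apply (n : ℕ) : (0 : StdModule A) n = 0 := rfl
@[simp] theorem smul_apply (c : ℂ) (x : StdModule A) (n : ℕ) : (c • x) n = c • x n := rfl

/-- The right action `(a_n) a = (a_n a)`. -/
instance : SMul Aᵐᵒᵖ (StdModule A) where
  smul a x := ⟨fun n => x n * unop a, by
    refine ((x.2.mul_left (star (unop a))).mul_right (unop a)).congr fun n => ?_
    simp [mul_assoc]⟩

@[simp] theorem op_smul_apply (a : A) (x : StdModule A) (n : ℕ) : (x <• a) n = x n * a := rfl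

/-- The inner product `⟨(a_n), (b_n)⟩ = ∑ a_n^* b_n`. -/
noncomputable instance : Inner Aᵐᵒᵖ (StdModule A) where
  inner x y := op (∑' n, star (x n) * y n)

theorem rinner_eq (x y : StdModule A) : rinner A x y = ∑' n, star (x n) * y n := rfl

noncomputable instance : Norm (StdModule A) where
  norm x := √‖rinner A x x‖

noncomputable instance : CStarModule Aᵐᵒᵖ (StdModule A) where
  inner_add_right {x y z} := by
    apply unop_injective
    change ∑' n, star (x n) * (y n + z n) = ∑' n, star (x n) * y n + ∑' n, star (x n) * z n
    rw [← (summable x y).tsum_add (summable x z)]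
    simp only [mul_add]
  inner_self_nonneg {x} := by
    change (0 : A) ≤ ∑' n, star (x n) * x n
    exact tsum_nonneg fun n => star_mul_self_nonneg _
  inner_self {x} := by
    constructor
    · intro h
      have h' : ∑' n, star (x n) * x n = 0 := congrArg unop h
      ext n
      have h1 := (summable x x).le_tsum n fun j _ => star_mul_self_nonneg (x j)
      rw [h'] at h1
      exact (CStarRing.star_mul_self_eq_zero_iff _).1 (le_antisymm h1 (star_mul_self_nonneg _))
    · rintro rfl
      apply unop_injective
      change ∑' n, star (0 : A) * 0 = 0
      simp
  inner_op_smul_right {a x y} := by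
    apply unop_injective
    change ∑' n, star (x n) * (y n * unop a) = (∑' n, star (x n) * y n) * unop a
    rw [← (summable x y).tsum_mul_right]
    simp only [mul_assoc]
  inner_smul_right_complex {z x y} := by
    apply unop_injective
    change ∑' n, star (x n) * (z • y n) = z • ∑' n, star (x n) * y n
    rw [← (summable x y).tsum_const_smul]
    simp only [mul_smul_comm]
  star_inner x y := by
    apply unop_injective
    change star (∑' n, star (x n) * y n) = ∑' n, star (y n) * x n
    rw [tsum_star]
    simp
  norm_eq_sqrt_norm_inner_self x := rfl

noncomputable instance : NormedAddCommGroup (StdModule A) := CStarModule.normedAddCommGroup Aᵐᵒᵖ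

noncomputable instance : NormedSpace ℂ (StdModule A) :=
  .ofCore (CStarModule.normedSpaceCore Aᵐᵒᵖ)

theorem norm_eq (x : StdModule A) : ‖x‖ = √‖∑' n, star (x n) * x n‖ := rfl

theorem norm_apply_le (x : StdModule A) (n : ℕ) : ‖x n‖ ≤ ‖x‖ := by
  rw [norm_eq]
  apply Real.le_sqrt_of_sq_le
  rw [sq, ← CStarRing.norm_star_mul_self]
  exact CStarAlgebra.norm_le_norm_of_nonneg_of_le (star_mul_self_nonneg _)
    ((summable x x).le_tsum n fun j _ => star_mul_self_nonneg (x j))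

/-- The sequence `e_i a` with `a` in position `i` and zeros elsewhere. -/
noncomputable def single (i : ℕ) (a : A) : StdModule A :=
  ⟨Pi.single i a, by
    refine summable_of_ne_finset_zero (s := {i}) fun n hn => ?_
    simp [Pi.single_eq_of_ne (Finset.notMem_singleton.1 hn)]⟩

theorem single_apply (i : ℕ) (a : A) (n : ℕ) : single i a n = if n = i then a else 0 :=
  Pi.single_apply i a n

theorem norm_single (i : ℕ) (a : A) : ‖single i a‖ = ‖a‖ := by
  have h : ∑' n, star (single i a n) * single i a n = star a * a := by
    rw [tsum_eq_single i fun n hn => by simp [single_apply, hn]]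
    simp [single_apply]
  rw [norm_eq, h, CStarRing.norm_star_mul_self, Real.sqrt_mul_self (norm_nonneg _)]

/-- The operator `(x_n) ↦ e_i (c x_j)`: the matrix with `c` in position `(i, j)`. -/
noncomputable def matrixUnit (i j : ℕ) (c : A) : StdModule A →L[ℂ] StdModule A :=
  LinearMap.mkContinuous
    { toFun := fun x => single i (c * x j)
      map_add' := fun x y => by
        ext n
        by_cases h : n = i <;> simp [single_apply, h, mul_add]
      map_smul' := fun z x => by
        ext n
        by_cases h : n = i <;> simp [single_apply, h, mul_smul_comm] } ‖c‖ fun x => by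
    change ‖single i (c * x j)‖ ≤ _
    rw [norm_single]
    exact (norm_mul_le _ _).trans (by gcongr; exact norm_apply_le x j)

theorem matrixUnit_apply (i j : ℕ) (c : A) (x : StdModule A) :
    matrixUnit i j c x = single i (c * x j) := rfl

/-- The operator on `H_A` given by a finite matrix over `A`. -/
noncomputable def matrixOp (a : ℕ × ℕ →₀ A) : StdModule A →L[ℂ] StdModule A :=
  ∑ p ∈ a.support, matrixUnit p.1 p.2 (a p)

/-- `matrixOp a` is matrix multiplication by `a`. -/
theorem matrixOp_apply (a : ℕ × ℕ →₀ A) (x : StdModule A) (N : ℕ)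
    (ha : a.support ⊆ Finset.range N ×ˢ Finset.range N) (i : ℕ) :
    matrixOp a x i = ∑ j ∈ Finset.range N, a (i, j) * x j := by
  have hsum : ∀ (s : Finset (ℕ × ℕ)) (f : ℕ × ℕ → StdModule A),
      (∑ p ∈ s, f p) i = ∑ p ∈ s, f p i := fun s f =>
    map_sum ((LinearMap.proj i : (ℕ → A) →ₗ[ℂ] A) ∘ₗ (stdSubmodule A).subtype) f s
  have h0 : matrixOp a = ∑ p ∈ Finset.range N ×ˢ Finset.range N, matrixUnit p.1 p.2 (a p) := by
    refine Finset.sum_subset ha fun p _ hp => ?_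
    rw [Finsupp.notMem_support_iff.1 hp]
    ext x n
    simp [matrixUnit_apply, single_apply]
  rw [h0, _root_.sum_apply, hsum, Finset.sum_product]
  simp only [matrixUnit_apply, single_apply]
  by_cases hi : i ∈ Finset.range N
  · rw [Finset.sum_eq_single_of_mem i hi fun k _ hk => by simp [hk.symm]]
    simp
  · rw [Finset.sum_eq_zero fun k hk => Finset.sum_eq_zero fun j _ => if_neg fun h => hi (by rwa [h])]
    refine (Finset.sum_eq_zero fun j _ => ?_).symm
    have : a (i, j) = 0 := by
      by_contra h
      exact hi (Finset.mem_product.1 (ha (Finsupp.mem_support_iff.2 h))).1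
    rw [this, zero_mul]

end StdModule

end StdModule

/-! ### Adjointable, positive and compact operators -/

section Operators

variable (A : Type*) [NonUnitalCStarAlgebra A] [PartialOrder A] [StarOrderedRing A]
  {E F : Type*} [NormedAddCommGroup E] [NormedSpace ℂ E] [SMul Aᵐᵒᵖ E] [CStarModule Aᵐᵒᵖ E]
  [NormedAddCommGroup F] [NormedSpace ℂ F] [SMul Aᵐᵒᵖ F] [CStarModule Aᵐᵒᵖ F]

/-- `S` is the adjoint of `T`: `⟨T x, y⟩ = ⟨x, S y⟩`. -/
def IsAdjoint (T : E →L[ℂ] F) (S : F →L[ℂ] E) : Prop :=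
  ∀ x y, rinner A (T x) y = rinner A x (S y)

/-- A bounded selfadjoint operator `T` with `⟨x, T x⟩ ≥ 0` for all `x`. -/
def IsPositiveOp (T : E →L[ℂ] E) : Prop :=
  IsAdjoint A T T ∧ ∀ x, 0 ≤ rinner A x (T x)

/-- `T` is a rank one operator `z ↦ x ⟨y, z⟩`. -/
def IsRankOne (T : E →L[ℂ] F) : Prop :=
  ∃ (x : F) (y : E), ∀ z, T z = x <• rinner A y z

/-- The compact operators in the sense of Hilbert modules: the operator norm closure of the linear
span of the rank one operators. -/
def compactOps : Set (E →L[ℂ] F) :=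
  closure (Submodule.span ℂ {T : E →L[ℂ] F | IsRankOne A T} : Set (E →L[ℂ] F))

end Operators

/-! ### Closed derivations and differentiable compact operators -/

section Derivation

variable {A B : Type*} [NonUnitalCStarAlgebra A] [NonUnitalCStarAlgebra B]

/-- A closed derivation `δ : 𝒜 → B` along `ρ : A → B`, with `δ(a^*) = -δ(a)^*`. -/
structure IsClosedDerivation (ρ : A →⋆ₙₐ[ℂ] B) {𝒜 : NonUnitalStarSubalgebra ℂ A}
    (δ : 𝒜 →ₗ[ℂ] B) : Prop where
  leibniz : ∀ a b : 𝒜, δ (a * b) = δ a * ρ b + ρ a * δ b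
  map_star : ∀ a : 𝒜, δ (star a) = -star (δ a)
  closed : ∀ (a : ℕ → 𝒜) (b : B), Tendsto (fun n => (a n : A)) atTop (𝓝 0) →
    Tendsto (fun n => δ (a n)) atTop (𝓝 b) → b = 0

variable [PartialOrder A] [StarOrderedRing A] [PartialOrder B] [StarOrderedRing B]
  {𝒜 : NonUnitalStarSubalgebra ℂ A}

/-- The operator on `H_A` given by a finite matrix over `𝒜`. -/
noncomputable def matOp (a : ℕ × ℕ →₀ 𝒜) : StdModule A →L[ℂ] StdModule A :=
  StdModule.matrixOp (a.mapRange (fun c : 𝒜 => (c : A)) rfl)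

/-- The operator on `H_B` given by the finite matrix `δ(a)`, with entries `δ(a_ij)`. -/
noncomputable def derivOp (δ : 𝒜 →ₗ[ℂ] B) (a : ℕ × ℕ →₀ 𝒜) : StdModule B →L[ℂ] StdModule B :=
  StdModule.matrixOp (a.mapRange δ (map_zero δ))

/-- The norm `‖a‖_δ = ‖a‖ + ‖δ(a)‖` of a finite matrix `a` over `𝒜`. -/
noncomputable def deltaNorm (δ : 𝒜 →ₗ[ℂ] B) (a : ℕ × ℕ →₀ 𝒜) : ℝ :=
  ‖matOp a‖ + ‖derivOp δ a‖

/-- The differentiable compact operators `𝒦(H_A)_δ`: the completion of the finite matrices over `𝒜`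
in the norm `‖·‖_δ`, realised inside the operators on `H_A` (which is possible as `δ` is closed): the
operators that are limits in operator norm of `‖·‖_δ`-Cauchy sequences of finite matrices. -/
def diffCompactOps (δ : 𝒜 →ₗ[ℂ] B) : Set (StdModule A →L[ℂ] StdModule A) :=
  {T | ∃ a : ℕ → (ℕ × ℕ →₀ 𝒜),
    (∀ ε > 0, ∃ N, ∀ m ≥ N, ∀ n ≥ N, deltaNorm δ (a m - a n) < ε) ∧
    Tendsto (fun n => matOp (a n)) atTop (𝓝 T)}

end Derivation

end DiffAbsorption

/-!
Rescaling the `ξ_i`, we may assume that `∑ ‖ξ_i‖ < 1`. Then `h = ∑ |ξ_i⟩⟨ξ_i|` is a compact positive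
contraction with dense range; let `r = (1 - h) / (1 + h)` be its Cayley transform. Since
`(1 + r) h (1 + r) = 1 - r²` and `r^k → 0` strongly, the vectors `(1 + r) r^k ξ_i` form a Parseval
frame of `X`, and their analysis operator is an isometry `W : X → H_A`. Put `K = W h^13 W*`. With
`N = k + l`, the matrix of `P K² = W h^26 W*` has the entries `⟨ξ_i, h^25 (r^N - r^(N + 2)) ξ_j⟩`.

The matrices `(⟨ξ_i, Q ξ_j⟩)` are multiplied by `(Q, Q') ↦ Q h Q'`, so the Leibniz rule applies to
them. It turns `r^(N + 1) = r^N - r^N h (1 + r)` into a recursion `D_(N + 1) = T D_N - e_N` for the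
derivatives of the matrices of the `r^N`, with bounded `e_N` and `‖T^n‖ = O(n)`. So these grow at
most quadratically, whereas `‖h^(2m) r^N‖ = O(N^(-m))`. Splitting `h^25 r^(a + b)` with `a ≈ b` into
`(h^12 r^a) h (h^12 r^b)`, we obtain derivatives of order `N^(-4)`. Hence the entries of `P K²` and
their derivatives are absolutely summable.
-/

namespace DiffAbsorption

section RInnerAlgebra

variable {A E : Type*} [NonUnitalCStarAlgebra A] [PartialOrder A]
  [NormedAddCommGroup E] [NormedSpace ℂ E] [SMul Aᵐᵒᵖ E] [CStarModule Aᵐᵒᵖ E]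

theorem rinner_add_right (x y z : E) : rinner A x (y + z) = rinner A x y + rinner A x z := by
  simp [rinner]

theorem rinner_add_left (x y z : E) : rinner A (x + y) z = rinner A x z + rinner A y z := by
  simp [rinner]

theorem rinner_smul_complex_right (x y : E) (c : ℂ) : rinner A x (c • y) = c • rinner A x y := by
  simp [rinner]

theorem rinner_smul_complex_left (x y : E) (c : ℂ) :
    rinner A (c • x) y = star c • rinner A x y := by
  simp [rinner]

theorem rinner_sub_right (x y z : E) : rinner A x (y - z) = rinner A x y - rinner A x z := by
  simp [rinner]

theorem rinner_smul_left (x y : E) (a : A) : rinner A (x <• a) y = star a * rinner A x y := by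
  rw [← star_rinner y, rinner_smul_right, star_mul, star_rinner]

theorem rinner_self_nonneg (x : E) : 0 ≤ rinner A x x :=
  CStarModule.inner_self_nonneg (A := Aᵐᵒᵖ) (x := x)

theorem norm_sq_eq_rinner (x : E) : ‖x‖ ^ 2 = ‖rinner A x x‖ :=
  CStarModule.norm_sq_eq Aᵐᵒᵖ

theorem rinner_self_eq_zero {x : E} : rinner A x x = 0 ↔ x = 0 := by
  rw [← norm_eq_zero, ← norm_sq_eq_rinner, sq_eq_zero_iff, norm_eq_zero]

theorem ext_rinner {x y : E} (h : ∀ z, rinner A z x = rinner A z y) : x = y := by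
  rw [← sub_eq_zero, ← rinner_self_eq_zero (A := A), rinner_sub_right, h, sub_self]

theorem op_smul_add (x : E) (a b : A) : x <• (a + b) = x <• a + x <• b :=
  ext_rinner (A := A) fun z => by
    simp only [rinner_smul_right, rinner_add_right, mul_add]

theorem op_smul_smul_complex (x : E) (c : ℂ) (a : A) : x <• (c • a) = c • (x <• a) :=
  ext_rinner (A := A) fun z => by
    simp only [rinner_smul_right, rinner_smul_complex_right, mul_smul_comm]

theorem norm_op_smul_le (x : E) (a : A) : ‖x <• a‖ ≤ ‖x‖ * ‖a‖ := by
  refine le_of_sq_le_sq ?_ (by positivity)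
  rw [norm_sq_eq_rinner (A := A), rinner_smul_right, rinner_smul_left, mul_pow,
    norm_sq_eq_rinner (A := A) x]
  calc _ ≤ ‖star a‖ * ‖rinner A x x‖ * ‖a‖ := norm_mul₃_le
    _ = _ := by rw [norm_star]; ring

/-- The map `a ↦ x a` as a continuous linear map. -/
noncomputable def opSMulCLM (x : E) : A →L[ℂ] E :=
  LinearMap.mkContinuous
    { toFun := fun a => x <• a
      map_add' := op_smul_add x
      map_smul' := op_smul_smul_complex x } ‖x‖ (norm_op_smul_le x)

end RInnerAlgebra

section RankOne

variable {A E F : Type*} [NonUnitalCStarAlgebra A] [PartialOrder A] [StarOrderedRing A]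
  [NormedAddCommGroup E] [NormedSpace ℂ E] [SMul Aᵐᵒᵖ E] [CStarModule Aᵐᵒᵖ E]
  [NormedAddCommGroup F] [NormedSpace ℂ F] [SMul Aᵐᵒᵖ F] [CStarModule Aᵐᵒᵖ F]

theorem norm_rinner_le (x y : E) : ‖rinner A x y‖ ≤ ‖x‖ * ‖y‖ :=
  CStarModule.norm_inner_le (A := Aᵐᵒᵖ) E

theorem norm_le_of_rinner_le {x : E} {y : F} (h : rinner A x x ≤ rinner A y y) : ‖x‖ ≤ ‖y‖ := by
  refine le_of_sq_le_sq ?_ (norm_nonneg _)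
  rw [norm_sq_eq_rinner (A := A), norm_sq_eq_rinner (A := A)]
  exact CStarAlgebra.norm_le_norm_of_nonneg_of_le (rinner_self_nonneg x) h

variable (A) in
/-- The inner product as a continuous linear map in its second variable. -/
noncomputable def rinnerCLM (x : E) : E →L[ℂ] A :=
  LinearMap.mkContinuous
    { toFun := rinner A x
      map_add' := rinner_add_right x
      map_smul' := fun c y => rinner_smul_complex_right x y c } ‖x‖ (norm_rinner_le x)

@[simp] theorem rinnerCLM_apply (x y : E) : rinnerCLM A x y = rinner A x y := rfl

variable (A) in
/-- The rank one operator `z ↦ x ⟨y, z⟩`. -/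
noncomputable def rankOne (x : F) (y : E) : E →L[ℂ] F := opSMulCLM x ∘L rinnerCLM A y

@[simp] theorem rankOne_apply (x : F) (y z : E) : rankOne A x y z = x <• rinner A y z := rfl

theorem norm_rankOne_le (x : F) (y : E) : ‖rankOne A x y‖ ≤ ‖x‖ * ‖y‖ :=
  ContinuousLinearMap.opNorm_le_bound _ (by positivity) fun z => by
    rw [rankOne_apply, mul_assoc]
    exact (norm_op_smul_le _ _).trans (by gcongr; exact norm_rinner_le y z)

theorem isRankOne_rankOne (x : F) (y : E) : IsRankOne A (rankOne A x y) := ⟨x, y, fun _ => rfl⟩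

end RankOne

namespace IsAdjoint

variable {A E F G : Type*} [NonUnitalCStarAlgebra A] [PartialOrder A]
  [NormedAddCommGroup E] [NormedSpace ℂ E] [SMul Aᵐᵒᵖ E] [CStarModule Aᵐᵒᵖ E]
  [NormedAddCommGroup F] [NormedSpace ℂ F] [SMul Aᵐᵒᵖ F] [CStarModule Aᵐᵒᵖ F]
  [NormedAddCommGroup G] [NormedSpace ℂ G] [SMul Aᵐᵒᵖ G] [CStarModule Aᵐᵒᵖ G]
  {T T' : E →L[ℂ] F} {S S' : F →L[ℂ] E}

theorem symm (h : IsAdjoint A T S) : IsAdjoint A S T :=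
  fun x y => by rw [← star_rinner y, ← h, star_rinner]

theorem map_op_smul (h : IsAdjoint A T S) (x : E) (a : A) : T (x <• a) = T x <• a :=
  ext_rinner (A := A) fun z => by rw [← h.symm, rinner_smul_right, rinner_smul_right, h.symm]

theorem comp {U : F →L[ℂ] G} {V : G →L[ℂ] F} (hU : IsAdjoint A U V) (hT : IsAdjoint A T S) :
    IsAdjoint A (U ∘L T) (S ∘L V) :=
  fun _ _ => (hU _ _).trans (hT _ _)

theorem one : IsAdjoint A (1 : E →L[ℂ] E) 1 := fun _ _ => rfl

theorem mul {T S T' S' : E →L[ℂ] E} (h : IsAdjoint A T S) (h' : IsAdjoint A T' S') :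
    IsAdjoint A (T * T') (S' * S) := h.comp h'

theorem add (h : IsAdjoint A T S) (h' : IsAdjoint A T' S') : IsAdjoint A (T + T') (S + S') :=
  fun x y => by
    simp only [_root_.add_apply, rinner_add_left, rinner_add_right, h x y, h' x y]

theorem smul (h : IsAdjoint A T S) (c : ℂ) : IsAdjoint A (c • T) (star c • S) := fun x y => by
  simp only [_root_.smul_apply, rinner_smul_complex_left, rinner_smul_complex_right, h x y]

theorem neg (h : IsAdjoint A T S) : IsAdjoint A (-T) (-S) := by
  simpa using h.smul (-1)

theorem sub (h : IsAdjoint A T S) (h' : IsAdjoint A T' S') : IsAdjoint A (T - T') (S - S') := by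
  simpa only [sub_eq_add_neg] using h.add h'.neg

theorem pow {T : E →L[ℂ] E} (h : IsAdjoint A T T) (n : ℕ) : IsAdjoint A (T ^ n) (T ^ n) := by
  induction n with
  | zero => exact one
  | succ n ih => simpa only [← pow_succ, ← pow_succ'] using ih.mul h

theorem eq_zero_of_rinner_apply_self {T : E →L[ℂ] E} (hT : IsAdjoint A T T)
    (h : ∀ x, rinner A x (T x) = 0) : T = 0 := by
  ext x
  rw [_root_.zero_apply, ← rinner_self_eq_zero (A := A)]
  -- Polarize in the single direction `T x`: this suffices because `T` is selfadjoint.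
  have hpol := h (x + T x)
  rw [map_add, rinner_add_left, rinner_add_right, rinner_add_right, h, h, zero_add, add_zero,
    ← hT x] at hpol
  simpa [← two_smul ℂ] using hpol

variable [StarOrderedRing A]

theorem rankOne (x : F) (y : E) : IsAdjoint A (rankOne A x y) (DiffAbsorption.rankOne A y x) :=
  fun z t => by
    rw [rankOne_apply, rankOne_apply, rinner_smul_left, rinner_smul_right, star_rinner]

theorem hasSum {ι : Type*} {T : ι → E →L[ℂ] F} {S : ι → F →L[ℂ] E} {T' : E →L[ℂ] F}
    {S' : F →L[ℂ] E} (h : ∀ i, IsAdjoint A (T i) (S i)) (hT : HasSum T T') (hS : HasSum S S') :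
    IsAdjoint A T' S' := fun x y => by
  have hTx : HasSum (fun i => rinner A y (T i x)) (rinner A y (T' x)) :=
    (rinnerCLM A y ∘L ContinuousLinearMap.apply ℂ F x).hasSum hT
  have hSy : HasSum (fun i => rinner A x (S i y)) (rinner A x (S' y)) :=
    (rinnerCLM A x ∘L ContinuousLinearMap.apply ℂ E y).hasSum hS
  have hTx' := hTx.star
  simp only [star_rinner, h _ x y] at hTx'
  exact hTx'.unique hSy

end IsAdjoint

theorem comp_mem_compactOps {A E F G H : Type*} [NonUnitalCStarAlgebra A] [PartialOrder A]
    [NormedAddCommGroup E] [NormedSpace ℂ E] [SMul Aᵐᵒᵖ E] [CStarModule Aᵐᵒᵖ E]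
    [NormedAddCommGroup F] [NormedSpace ℂ F] [SMul Aᵐᵒᵖ F] [CStarModule Aᵐᵒᵖ F]
    [NormedAddCommGroup G] [NormedSpace ℂ G] [SMul Aᵐᵒᵖ G] [CStarModule Aᵐᵒᵖ G]
    [NormedAddCommGroup H] [NormedSpace ℂ H] [SMul Aᵐᵒᵖ H] [CStarModule Aᵐᵒᵖ H]
    {S : F →L[ℂ] G} {S' : G →L[ℂ] F} (hS : IsAdjoint A S S')
    {R : H →L[ℂ] E} {R' : E →L[ℂ] H} (hR : IsAdjoint A R R')
    {T : E →L[ℂ] F} (hT : T ∈ compactOps A) : S ∘L T ∘L R ∈ compactOps A := by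
  let conj : (E →L[ℂ] F) →L[ℂ] (H →L[ℂ] G) :=
    (ContinuousLinearMap.compL ℂ H F G S).comp ((ContinuousLinearMap.compL ℂ H E F).flip R)
  change conj T ∈ _
  refine map_mem_closure conj.continuous hT fun T hT => ?_
  induction hT using Submodule.span_induction with
  | mem T hT =>
    obtain ⟨x, y, h⟩ := hT
    refine Submodule.subset_span ⟨S x, R' y, fun z => ?_⟩
    change S (T (R z)) = _
    rw [h, hS.map_op_smul, hR.symm y z]
  | zero => simp
  | add T T' _ _ h h' => rw [map_add]; exact add_mem h h'
  | smul c T _ h => rw [map_smul]; exact Submodule.smul_mem _ c h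

section NonnegSums

variable {A ι κ : Type*} [NonUnitalCStarAlgebra A] [PartialOrder A] [StarOrderedRing A]

theorem hasSum_of_sum_le_of_forall_exists {f : ι → A} {a : A} (hf : ∀ i, 0 ≤ f i)
    (hle : ∀ s, ∑ i ∈ s, f i ≤ a) (h : ∀ ε > 0, ∃ s, ‖a - ∑ i ∈ s, f i‖ < ε) : HasSum f a := by
  refine Metric.tendsto_nhds.2 fun ε hε => ?_
  obtain ⟨s, hs⟩ := h ε hε
  rw [SummationFilter.unconditional_filter]
  filter_upwards [eventually_ge_atTop s] with t hst
  rw [dist_eq_norm, norm_sub_rev]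
  refine (CStarAlgebra.norm_le_norm_of_nonneg_of_le (sub_nonneg.2 (hle t)) ?_).trans_lt hs
  exact sub_le_sub_left (Finset.sum_le_sum_of_subset_of_nonneg hst fun i _ _ => hf i) _

theorem hasSum_of_tendsto_sum_range_of_nonneg {f : ℕ → A} {a : A} (hf : ∀ n, 0 ≤ f n)
    (h : Tendsto (fun N => ∑ n ∈ Finset.range N, f n) atTop (𝓝 a)) : HasSum f a := by
  have hmono : Monotone fun N => ∑ n ∈ Finset.range N, f n := fun M N hMN =>
    Finset.sum_le_sum_of_subset_of_nonneg (Finset.range_subset_range.2 hMN) fun i _ _ => hf i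
  refine hasSum_of_sum_le_of_forall_exists hf (fun s => ?_) fun ε hε => ?_
  · obtain ⟨N, hN⟩ := s.exists_nat_subset_range
    exact (Finset.sum_le_sum_of_subset_of_nonneg hN fun i _ _ => hf i).trans
      (hmono.ge_of_tendsto h N)
  · obtain ⟨N, hN⟩ := (Metric.tendsto_nhds.1 h ε hε).exists
    exact ⟨Finset.range N, by rwa [norm_sub_rev, ← dist_eq_norm]⟩

theorem hasSum_prod_of_nonneg {f : ι × κ → A} {g : κ → A} {a : A} (hf : ∀ p, 0 ≤ f p)
    (hg : ∀ k, HasSum (fun i => f (i, k)) (g k)) (ha : HasSum g a) : HasSum f a := by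
  classical
  have hg0 : ∀ k, 0 ≤ g k := fun k => (hg k).nonneg fun i => hf _
  refine hasSum_of_sum_le_of_forall_exists hf (fun s => ?_) fun ε hε => ?_
  · calc ∑ p ∈ s, f p
        ≤ ∑ p ∈ s.image Prod.fst ×ˢ s.image Prod.snd, f p :=
          Finset.sum_le_sum_of_subset_of_nonneg Finset.subset_product fun p _ _ => hf p
      _ = ∑ k ∈ s.image Prod.snd, ∑ i ∈ s.image Prod.fst, f (i, k) := Finset.sum_product_right _ _ _
      _ ≤ ∑ k ∈ s.image Prod.snd, g k :=
          Finset.sum_le_sum fun k _ => sum_le_hasSum _ (fun i _ => hf _) (hg k)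
      _ ≤ a := sum_le_hasSum _ (fun k _ => hg0 k) ha
  · obtain ⟨t, ht⟩ := (Metric.tendsto_nhds.1 ha ε hε).exists
    have hrows : Tendsto (fun u : Finset ι => ∑ k ∈ t, ∑ i ∈ u, f (i, k)) atTop
        (𝓝 (∑ k ∈ t, g k)) := tendsto_finsetSum _ fun k _ => hg k
    have hball : Metric.ball a ε ∈ 𝓝 (∑ k ∈ t, g k) := Metric.isOpen_ball.mem_nhds ht
    obtain ⟨u, hu⟩ := (hrows.eventually hball).exists
    refine ⟨u ×ˢ t, ?_⟩
    rw [Finset.sum_product_right, norm_sub_rev, ← dist_eq_norm]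
    exact hu

end NonnegSums

section Frame

variable {A X : Type*} [NonUnitalCStarAlgebra A] [PartialOrder A] [StarOrderedRing A]
  [NormedAddCommGroup X] [NormedSpace ℂ X] [SMul Aᵐᵒᵖ X] [CStarModule Aᵐᵒᵖ X]

variable (A) in
/-- A normalised (Parseval) frame: `∑ ⟨x, η_n⟩ ⟨η_n, x⟩ = ⟨x, x⟩` for all `x`, with norm convergent
sums. -/
def IsParsevalFrame (η : ℕ → X) : Prop :=
  ∀ x, HasSum (fun n => star (rinner A (η n) x) * rinner A (η n) x) (rinner A x x)

namespace IsParsevalFrame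

variable {η : ℕ → X} (hη : IsParsevalFrame A η)
include hη

/-- The sequence `(⟨η_n, x⟩)` of frame coefficients of `x`. -/
noncomputable def coeff (x : X) : StdModule A := ⟨fun n => rinner A (η n) x, (hη x).summable⟩

theorem rinner_coeff_self (x : X) : rinner A (hη.coeff x) (hη.coeff x) = rinner A x x :=
  (hη x).tsum_eq

theorem norm_coeff (x : X) : ‖hη.coeff x‖ = ‖x‖ :=
  le_antisymm (norm_le_of_rinner_le (hη.rinner_coeff_self x).le)
    (norm_le_of_rinner_le (hη.rinner_coeff_self x).ge)

/-- The analysis operator `x ↦ (⟨η_n, x⟩)` of a Parseval frame. -/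
noncomputable def analysis : X →L[ℂ] StdModule A :=
  LinearMap.mkContinuous
    { toFun := hη.coeff
      map_add' := fun x y => StdModule.ext fun n => rinner_add_right (η n) x y
      map_smul' := fun c x => StdModule.ext fun n => rinner_smul_complex_right (η n) x c } 1
    fun x => by rw [one_mul]; exact (hη.norm_coeff x).le

theorem analysis_apply (x : X) (n : ℕ) : hη.analysis x n = rinner A (η n) x := rfl

theorem norm_sum_op_smul_le (s : Finset ℕ) (a : ℕ → A) :
    ‖∑ n ∈ s, η n <• a n‖ ≤ √‖∑ n ∈ s, star (a n) * a n‖ := by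
  set y := ∑ n ∈ s, η n <• a n
  have hyy : rinner A y y = ∑ n ∈ s, star (rinner A (η n) y) * a n := by
    have hzy (z : X) : rinner A z y = ∑ n ∈ s, rinner A z (η n) * a n := by
      rw [← rinnerCLM_apply, map_sum]
      simp only [rinnerCLM_apply, rinner_smul_right]
    simpa only [star_rinner] using hzy y
  have hcoeff : √‖∑ n ∈ s, star (rinner A (η n) y) * rinner A (η n) y‖ ≤ ‖y‖ := by
    rw [Real.sqrt_le_left (norm_nonneg y), norm_sq_eq_rinner (A := A)]
    exact CStarAlgebra.norm_le_norm_of_nonneg_of_le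
      (Finset.sum_nonneg fun i _ => star_mul_self_nonneg _)
      (sum_le_hasSum s (fun i _ => star_mul_self_nonneg _) (hη y))
  have hsq : ‖y‖ * ‖y‖ ≤ ‖y‖ * √‖∑ n ∈ s, star (a n) * a n‖ := by
    calc ‖y‖ * ‖y‖ = ‖∑ n ∈ s, star (rinner A (η n) y) * a n‖ := by
          rw [← sq, norm_sq_eq_rinner (A := A), hyy]
      _ ≤ _ := norm_sum_star_mul_le s _ a
      _ ≤ _ := by gcongr
  rcases (norm_nonneg y).eq_or_lt with h0 | h0
  · rw [← h0]; positivity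
  · exact le_of_mul_le_mul_left hsq h0

variable [CompleteSpace X]

theorem summable_op_smul (a : StdModule A) : Summable fun n => η n <• a n := by
  rw [summable_iff_vanishing_norm]
  intro ε hε
  obtain ⟨s, hs⟩ := summable_iff_vanishing_norm.1 a.2 (ε ^ 2) (by positivity)
  refine ⟨s, fun t ht => (hη.norm_sum_op_smul_le t _).trans_lt ?_⟩
  exact (Real.sqrt_lt_sqrt (norm_nonneg _) (hs t ht)).trans_eq (Real.sqrt_sq hε.le)

/-- The synthesis operator `(a_n) ↦ ∑ η_n a_n` of a Parseval frame. -/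
noncomputable def synthesis : StdModule A →L[ℂ] X :=
  LinearMap.mkContinuous
    { toFun := fun a => ∑' n, η n <• a n
      map_add' := fun a b => by
        rw [← (hη.summable_op_smul a).tsum_add (hη.summable_op_smul b)]
        exact tsum_congr fun n => op_smul_add (η n) (a n) (b n)
      map_smul' := fun c a => by
        rw [RingHom.id_apply, ← (hη.summable_op_smul a).tsum_const_smul]
        exact tsum_congr fun n => op_smul_smul_complex (η n) c (a n) } 1
    fun a => by
      rw [one_mul, StdModule.norm_eq]
      exact le_of_tendsto_of_tendsto (hη.summable_op_smul a).hasSum.norm a.2.hasSum.norm.sqrt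
        (Eventually.of_forall fun s => hη.norm_sum_op_smul_le s _)

theorem isAdjoint_analysis : IsAdjoint A hη.analysis hη.synthesis := fun x a => by
  have h := (rinnerCLM A x).hasSum (hη.summable_op_smul a).hasSum
  simp only [rinnerCLM_apply, rinner_smul_right] at h
  refine Eq.trans ?_ h.tsum_eq
  simp only [StdModule.rinner_eq, analysis_apply, star_rinner]

theorem synthesis_comp_analysis : hη.synthesis ∘L hη.analysis = 1 := by
  have hadj := hη.isAdjoint_analysis
  refine sub_eq_zero.1 (((hadj.symm.comp hadj).sub .one).eq_zero_of_rinner_apply_self fun x => ?_)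
  change rinner A x (hη.synthesis (hη.analysis x) - x) = 0
  rw [rinner_sub_right, ← hadj, sub_eq_zero]
  exact hη.rinner_coeff_self x

theorem synthesis_analysis (x : X) : hη.synthesis (hη.analysis x) = x :=
  DFunLike.congr_fun hη.synthesis_comp_analysis x

theorem rinner_analysis (x y : X) : rinner A (hη.analysis x) (hη.analysis y) = rinner A x y := by
  rw [hη.isAdjoint_analysis, synthesis_analysis]

/-- The operator `W T W*` on `H_A` corresponding to an operator `T` on `X`, where `W` is the
analysis operator. -/
noncomputable def conj (T : X →L[ℂ] X) : StdModule A →L[ℂ] StdModule A :=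
  hη.analysis ∘L T ∘L hη.synthesis

theorem hasSum_conj_apply {T S : X →L[ℂ] X} (hT : IsAdjoint A T S) (a : StdModule A) (m : ℕ) :
    HasSum (fun n => rinner A (η m) (T (η n)) * a n) (hη.conj T a m) := by
  have h := (rinnerCLM A (η m) ∘L T).hasSum (hη.summable_op_smul a).hasSum
  simp only [ContinuousLinearMap.comp_apply, rinnerCLM_apply, hT.map_op_smul,
    rinner_smul_right] at h
  exact h

theorem synthesis_comp_conj_comp_analysis (T : X →L[ℂ] X) :
    hη.synthesis ∘L hη.conj T ∘L hη.analysis = T := by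
  ext x
  simp only [conj, ContinuousLinearMap.comp_apply, synthesis_analysis]

theorem conj_comp_conj (T S : X →L[ℂ] X) : hη.conj T ∘L hη.conj S = hη.conj (T * S) := by
  ext1 a
  simp only [conj, ContinuousLinearMap.comp_apply, synthesis_analysis]
  rfl

theorem conj_comp_analysis_comp_synthesis (T : X →L[ℂ] X) :
    hη.conj T ∘L (hη.analysis ∘L hη.synthesis) = hη.conj T :=
  (hη.conj_comp_conj T 1).trans (by rw [mul_one])

theorem analysis_comp_synthesis_comp_conj (T : X →L[ℂ] X) :
    (hη.analysis ∘L hη.synthesis) ∘L hη.conj T = hη.conj T :=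
  (hη.conj_comp_conj 1 T).trans (by rw [one_mul])

theorem isPositiveOp_conj {T : X →L[ℂ] X} (hT : IsPositiveOp A T) :
    IsPositiveOp A (hη.conj T) :=
  ⟨hη.isAdjoint_analysis.comp (hT.1.comp hη.isAdjoint_analysis.symm), fun a =>
    (hT.2 (hη.synthesis a)).trans_eq (hη.isAdjoint_analysis.symm a _)⟩

theorem conj_mem_compactOps {T : X →L[ℂ] X} (hT : T ∈ compactOps A) :
    hη.conj T ∈ compactOps A :=
  comp_mem_compactOps hη.isAdjoint_analysis hη.isAdjoint_analysis.symm hT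

end IsParsevalFrame

end Frame

namespace StdModule

variable {A : Type*} [NonUnitalCStarAlgebra A] [PartialOrder A] [StarOrderedRing A]

theorem norm_sum_star_mul_self_le (x : StdModule A) (t : Finset ℕ) :
    ‖∑ n ∈ t, star (x n) * x n‖ ≤ ‖x‖ ^ 2 := by
  rw [norm_eq, Real.sq_sqrt (norm_nonneg _)]
  exact CStarAlgebra.norm_le_norm_of_nonneg_of_le
    (Finset.sum_nonneg fun i _ => star_mul_self_nonneg _)
    ((summable x x).sum_le_tsum t fun i _ => star_mul_self_nonneg _)

theorem norm_le_of_forall_norm_sum_le {x : StdModule A} {C : ℝ} (hC : 0 ≤ C)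
    (h : ∀ t : Finset ℕ, ‖∑ n ∈ t, star (x n) * x n‖ ≤ C ^ 2) : ‖x‖ ≤ C :=
  Real.sqrt_le_iff.2 ⟨hC, le_of_tendsto (summable x x).hasSum.norm (Eventually.of_forall h)⟩

theorem norm_sum_star_mul_self_add_le (x y : ℕ → A) (t : Finset ℕ) :
    ‖∑ n ∈ t, star (x n + y n) * (x n + y n)‖ ≤
      2 * ‖∑ n ∈ t, star (x n) * x n‖ + 2 * ‖∑ n ∈ t, star (y n) * y n‖ := by
  have hle : ∑ n ∈ t, star (x n + y n) * (x n + y n) ≤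
      2 • ∑ n ∈ t, star (x n) * x n + 2 • ∑ n ∈ t, star (y n) * y n := by
    simp only [Finset.smul_sum, ← Finset.sum_add_distrib]
    refine Finset.sum_le_sum fun n _ => sub_nonneg.1 ?_
    refine (star_mul_self_nonneg (x n - y n)).trans_eq ?_
    simp only [star_add, star_sub, add_mul, mul_add, sub_mul, mul_sub, two_nsmul]
    abel
  calc _ ≤ _ := CStarAlgebra.norm_le_norm_of_nonneg_of_le
        (Finset.sum_nonneg fun i _ => star_mul_self_nonneg _) hle
    _ ≤ _ := norm_add_le _ _
    _ ≤ _ := by simpa using add_le_add (norm_nsmul_le (n := 2)) (norm_nsmul_le (n := 2))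

theorem summable_star_mul_self_of_approx {x : ℕ → A}
    (h : ∀ ε > 0, ∃ y : StdModule A, ∀ t : Finset ℕ,
      ‖∑ n ∈ t, star (x n - y n) * (x n - y n)‖ ≤ ε) :
    Summable fun n => star (x n) * x n := by
  rw [summable_iff_vanishing_norm]
  intro ε hε
  obtain ⟨y, hy⟩ := h (ε / 8) (by positivity)
  obtain ⟨s, hs⟩ := summable_iff_vanishing_norm.1 y.2 (ε / 4) (by positivity)
  refine ⟨s, fun t ht => ?_⟩
  have hxy := norm_sum_star_mul_self_add_le (fun n => x n - y n) y t
  simp only [sub_add_cancel] at hxy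
  linarith [hy t, hs t ht]

theorem norm_sum_star_mul_self_le_of_tendsto {ι : Type*} {l : Filter ι} [l.NeBot]
    {u : ι → StdModule A} {x : ℕ → A} {C : ℝ} (hx : ∀ n, Tendsto (fun k => u k n) l (𝓝 (x n)))
    (hu : ∀ᶠ k in l, ‖u k‖ ≤ C) (t : Finset ℕ) : ‖∑ n ∈ t, star (x n) * x n‖ ≤ C ^ 2 := by
  have hlim : Tendsto (fun k => ∑ n ∈ t, star (u k n) * u k n) l
      (𝓝 (∑ n ∈ t, star (x n) * x n)) := tendsto_finsetSum _ fun n _ => (hx n).star.mul (hx n)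
  refine le_of_tendsto hlim.norm (hu.mono fun k hk => ?_)
  exact (norm_sum_star_mul_self_le (u k) t).trans (by gcongr)

/-- The coordinate `x ↦ x n` as a continuous linear map. -/
noncomputable def coordCLM (n : ℕ) : StdModule A →L[ℂ] A :=
  LinearMap.mkContinuous
    { toFun := fun x => x n
      map_add' := fun _ _ => rfl
      map_smul' := fun _ _ => rfl } 1 fun x => (norm_apply_le x n).trans_eq (one_mul _).symm

@[simp] theorem coordCLM_apply (n : ℕ) (x : StdModule A) : coordCLM n x = x n := rfl

instance : CompleteSpace (StdModule A) := by
  refine Metric.complete_of_cauchySeq_tendsto fun u hu => ?_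
  have hcoord (n : ℕ) : ∃ a, Tendsto (fun k => u k n) atTop (𝓝 a) :=
    cauchySeq_tendsto_of_complete (hu.map (coordCLM (A := A) n).uniformContinuous)
  choose x hx using hcoord
  have hclose : ∀ ε > 0, ∃ N, ∀ k ≥ N, ∀ t : Finset ℕ,
      ‖∑ n ∈ t, star (x n - u k n) * (x n - u k n)‖ ≤ ε ^ 2 := fun ε hε => by
    obtain ⟨N, hN⟩ := Metric.cauchySeq_iff.1 hu ε hε
    refine ⟨N, fun k hk => norm_sum_star_mul_self_le_of_tendsto (u := fun l => u l - u k)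
      (fun n => (hx n).sub_const _) (eventually_ge_atTop N |>.mono fun l hl => ?_)⟩
    rw [← dist_eq_norm]
    exact (hN l hl k hk).le
  have hmem : Summable fun n => star (x n) * x n :=
    summable_star_mul_self_of_approx fun ε hε => by
      obtain ⟨N, hN⟩ := hclose (√ε) (Real.sqrt_pos.2 hε)
      exact ⟨u N, by simpa only [Real.sq_sqrt hε.le] using hN N le_rfl⟩
  let z : StdModule A := ⟨x, hmem⟩
  refine ⟨z, Metric.tendsto_atTop.2 fun ε hε => ?_⟩
  obtain ⟨N, hN⟩ := hclose (ε / 2) (half_pos hε)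
  refine ⟨N, fun k hk => ?_⟩
  rw [dist_comm, dist_eq_norm]
  exact (norm_le_of_forall_norm_sum_le (half_pos hε).le (hN k hk)).trans_lt (half_lt_self hε)

theorem norm_matrixUnit_le (i j : ℕ) (c : A) : ‖matrixUnit i j c‖ ≤ ‖c‖ :=
  LinearMap.mkContinuous_norm_le _ (norm_nonneg c) _

/-- The matrix unit `matrixUnit i j` as a continuous linear map of its coefficient. -/
noncomputable def matrixUnitCLM (i j : ℕ) : A →L[ℂ] (StdModule A →L[ℂ] StdModule A) :=
  LinearMap.mkContinuous
    { toFun := matrixUnit i j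
      map_add' := fun c d => by
        ext x n
        by_cases h : n = i <;> simp [matrixUnit_apply, single_apply, h, add_mul]
      map_smul' := fun z c => by
        ext x n
        by_cases h : n = i <;> simp [matrixUnit_apply, single_apply, h, smul_mul_assoc] } 1
    fun c => (norm_matrixUnit_le i j c).trans_eq (one_mul _).symm

theorem matrixOp_eq_sum (a : ℕ × ℕ →₀ A) :
    matrixOp a = a.sum fun p c => matrixUnitCLM p.1 p.2 c := rfl

theorem matrixOp_add (a b : ℕ × ℕ →₀ A) : matrixOp (a + b) = matrixOp a + matrixOp b := by
  simp only [matrixOp_eq_sum]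
  exact Finsupp.sum_add_index' (fun _ => map_zero _) fun _ => map_add _

theorem matrixOp_smul (c : ℂ) (a : ℕ × ℕ →₀ A) : matrixOp (c • a) = c • matrixOp a := by
  simp only [matrixOp_eq_sum]
  rw [Finsupp.sum_smul_index' fun _ => map_zero _, Finsupp.smul_sum]
  simp only [map_smul]

theorem matrixOp_single (p : ℕ × ℕ) (c : A) :
    matrixOp (Finsupp.single p c) = matrixUnit p.1 p.2 c := by
  rw [matrixOp_eq_sum]
  exact Finsupp.sum_single_index (map_zero _)

theorem matrixOp_mapRange_single {C : Type*} [Zero C] (f : C → A) (hf : f 0 = 0) (p : ℕ × ℕ)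
    (c : C) : matrixOp ((Finsupp.single p c).mapRange f hf) = matrixUnit p.1 p.2 (f c) := by
  rw [Finsupp.mapRange_single, matrixOp_single]

theorem hasSum_matrixUnit {a : ℕ → ℕ → A}
    (ha : Summable fun p : ℕ × ℕ => ‖a p.1 p.2‖) {T : StdModule A →L[ℂ] StdModule A}
    (hT : ∀ x i, HasSum (fun j => a i j * x j) (T x i)) :
    HasSum (fun p : ℕ × ℕ => matrixUnit p.1 p.2 (a p.1 p.2)) T := by
  have hsum : Summable fun p : ℕ × ℕ => matrixUnit p.1 p.2 (a p.1 p.2) :=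
    .of_norm_bounded ha fun p => norm_matrixUnit_le _ _ _
  convert hsum.hasSum using 1
  ext x i
  have hentry := (coordCLM i ∘L ContinuousLinearMap.apply ℂ (StdModule A) x).hasSum hsum.hasSum
  simp only [ContinuousLinearMap.comp_apply, ContinuousLinearMap.apply_apply, coordCLM_apply,
    matrixUnit_apply, single_apply] at hentry
  have hrow := (Function.Injective.hasSum_iff (g := fun j : ℕ => (i, j))
    (fun _ _ h => (Prod.mk.inj h).2) fun p hp => if_neg fun h => hp ⟨p.2, by rw [h]⟩).2 hentry
  simp only [Function.comp_def, if_true] at hrow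
  exact (hT x i).unique hrow

end StdModule

section GraphClosure

variable {A B : Type*} [NonUnitalCStarAlgebra A] [NonUnitalCStarAlgebra B]
  {𝒜 : NonUnitalStarSubalgebra ℂ A}

/-- The Leibniz rule for a linear map `δ : 𝒜 → B` along `ρ : A → B`. -/
def IsDerivationAlong (ρ : A →⋆ₙₐ[ℂ] B) (δ : 𝒜 →ₗ[ℂ] B) : Prop :=
  ∀ a b : 𝒜, δ (a * b) = δ a * ρ b + ρ a * δ b

/-- The closure in `A × B` of the graph of `δ`. -/
def graphClosure (δ : 𝒜 →ₗ[ℂ] B) : Submodule ℂ (A × B) :=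
  (LinearMap.range ((NonUnitalSubalgebraClass.subtype 𝒜 : 𝒜 →ₗ[ℂ] A).prod δ)).topologicalClosure

theorem mem_graphClosure (δ : 𝒜 →ₗ[ℂ] B) (a : 𝒜) : ((a : A), δ a) ∈ graphClosure δ :=
  Submodule.le_topologicalClosure _ ⟨a, rfl⟩

theorem isClosed_graphClosure (δ : 𝒜 →ₗ[ℂ] B) : IsClosed (graphClosure δ : Set (A × B)) :=
  Submodule.isClosed_topologicalClosure _

open scoped CStarAlgebra in
theorem IsDerivationAlong.mul_mem_graphClosure {ρ : A →⋆ₙₐ[ℂ] B} {δ : 𝒜 →ₗ[ℂ] B}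
    (hδ : IsDerivationAlong ρ δ) {p q : A × B} (hp : p ∈ graphClosure δ)
    (hq : q ∈ graphClosure δ) : (p.1 * q.1, p.2 * ρ q.1 + ρ p.1 * q.2) ∈ graphClosure δ := by
  have hρ : Continuous ρ := map_continuous ρ
  refine map_mem_closure₂ (f := fun p q : A × B => (p.1 * q.1, p.2 * ρ q.1 + ρ p.1 * q.2))
    (by fun_prop) hp hq ?_
  rintro _ ⟨a, rfl⟩ _ ⟨b, rfl⟩
  exact ⟨a * b, Prod.ext rfl (hδ a b)⟩

theorem hasSum_mem_graphClosure {δ : 𝒜 →ₗ[ℂ] B} {ι : Type*} {f : ι → A} {g : ι → B} {a : A} {b : B}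
    (h : ∀ i, (f i, g i) ∈ graphClosure δ) (hf : HasSum f a) (hg : HasSum g b) :
    (a, b) ∈ graphClosure δ :=
  (isClosed_graphClosure δ).mem_of_tendsto (hf.prodMk hg)
    (Eventually.of_forall fun _ => sum_mem fun i _ => h i)

end GraphClosure

section DiffCompactOps

variable {A B : Type*} [NonUnitalCStarAlgebra A] [NonUnitalCStarAlgebra B]
  [PartialOrder A] [StarOrderedRing A] [PartialOrder B] [StarOrderedRing B]
  {𝒜 : NonUnitalStarSubalgebra ℂ A}

/-- The map `a ↦ (a, δ(a))` from finite matrices over `𝒜` to pairs of operators. -/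
noncomputable def matDerivOp (δ : 𝒜 →ₗ[ℂ] B) : (ℕ × ℕ →₀ 𝒜) →ₗ[ℂ]
    (StdModule A →L[ℂ] StdModule A) × (StdModule B →L[ℂ] StdModule B) where
  toFun a := (matOp a, derivOp δ a)
  map_add' a b := Prod.ext
    ((congrArg StdModule.matrixOp (Finsupp.mapRange_add (fun _ _ => rfl) a b)).trans
      (StdModule.matrixOp_add _ _))
    ((congrArg StdModule.matrixOp (Finsupp.mapRange_add (map_add δ) a b)).trans
      (StdModule.matrixOp_add _ _))
  map_smul' c a := Prod.ext
    ((congrArg StdModule.matrixOp (Finsupp.mapRange_smul c a fun _ => rfl)).trans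
      (StdModule.matrixOp_smul _ _))
    ((congrArg StdModule.matrixOp (Finsupp.mapRange_smul c a (map_smul δ c))).trans
      (StdModule.matrixOp_smul _ _))

theorem mem_diffCompactOps_of_mem_closure {δ : 𝒜 →ₗ[ℂ] B}
    {T : StdModule A →L[ℂ] StdModule A} {S : StdModule B →L[ℂ] StdModule B}
    (h : (T, S) ∈ (LinearMap.range (matDerivOp δ)).topologicalClosure) :
    T ∈ diffCompactOps δ := by
  obtain ⟨u, hu, hlim⟩ := mem_closure_iff_seq_limit.1 h
  choose a ha using hu
  obtain rfl : (fun n => matDerivOp δ (a n)) = u := funext ha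
  refine ⟨a, fun ε hε => ?_, (continuous_fst.tendsto _).comp hlim⟩
  obtain ⟨N, hN⟩ := Metric.cauchySeq_iff.1 hlim.cauchySeq (ε / 2) (by positivity)
  refine ⟨N, fun m hm n hn => ?_⟩
  have hmn := hN m hm n hn
  rw [dist_eq_norm, ← map_sub] at hmn
  have hfst : ‖matOp (a m - a n)‖ < ε / 2 := (norm_fst_le _).trans_lt hmn
  have hsnd : ‖derivOp δ (a m - a n)‖ < ε / 2 := (norm_snd_le _).trans_lt hmn
  rw [deltaNorm]
  linarith

theorem matrixUnit_mem_closure {δ : 𝒜 →ₗ[ℂ] B} {a : A} {b : B} (h : (a, b) ∈ graphClosure δ)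
    (i j : ℕ) : (StdModule.matrixUnit i j a, StdModule.matrixUnit i j b) ∈
      (LinearMap.range (matDerivOp δ)).topologicalClosure := by
  refine map_mem_closure (f := fun p : A × B =>
    (StdModule.matrixUnitCLM i j p.1, StdModule.matrixUnitCLM i j p.2)) (by fun_prop) h ?_
  rintro _ ⟨c, rfl⟩
  exact ⟨Finsupp.single (i, j) c, Prod.ext (StdModule.matrixOp_mapRange_single _ rfl _ _)
    (StdModule.matrixOp_mapRange_single _ (map_zero δ) _ _)⟩

theorem mem_diffCompactOps_of_summable {δ : 𝒜 →ₗ[ℂ] B} {a : ℕ → ℕ → A} {b : ℕ → ℕ → B}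
    (hab : ∀ i j, (a i j, b i j) ∈ graphClosure δ)
    (ha : Summable fun p : ℕ × ℕ => ‖a p.1 p.2‖) (hb : Summable fun p : ℕ × ℕ => ‖b p.1 p.2‖)
    {T : StdModule A →L[ℂ] StdModule A} (hT : ∀ x i, HasSum (fun j => a i j * x j) (T x i)) :
    T ∈ diffCompactOps δ := by
  have hb' : Summable fun p : ℕ × ℕ => StdModule.matrixUnit p.1 p.2 (b p.1 p.2) :=
    .of_norm_bounded hb fun p => StdModule.norm_matrixUnit_le _ _ _
  exact mem_diffCompactOps_of_mem_closure <|
    (Submodule.isClosed_topologicalClosure _).mem_of_tendsto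
      ((StdModule.hasSum_matrixUnit ha hT).prodMk hb'.hasSum)
      (Eventually.of_forall fun _ => sum_mem fun p _ => matrixUnit_mem_closure (hab _ _) _ _)

end DiffCompactOps

section Cayley

variable {R : Type*} [NormedRing R]

/-- The Cayley transform `(1 - h) / (1 + h)`, given by the Neumann series of `2 / (1 + h)`; it is
meaningful for `‖h‖ < 1`. -/
noncomputable def cayley (h : R) : R := 2 * ∑' n : ℕ, (-h) ^ n - 1

theorem commute_cayley (h : R) : Commute h (cayley h) := by
  have hcomm : Commute h (∑' n : ℕ, (-h) ^ n) :=
    .tsum_right h fun n => (Commute.refl h).neg_right.pow_right n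
  exact ((Commute.ofNat_right h 2).mul_right hcomm).sub_right (.one_right h)

variable [CompleteSpace R] {h : R} (hlt : ‖h‖ < 1)
include hlt

theorem hasSum_one_add_cayley : HasSum (fun n : ℕ => 2 * (-h) ^ n) (1 + cayley h) := by
  have hgeom := (summable_geometric_of_norm_lt_one (x := -h) (by rwa [norm_neg])).hasSum
  rw [cayley, add_sub_cancel]
  exact hgeom.mul_left (2 : R)

theorem one_add_mul_one_add_cayley : (1 + h) * (1 + cayley h) = 2 := by
  have hgeom := mul_neg_geom_series (-h) (by rwa [norm_neg])
  rw [sub_neg_eq_add] at hgeom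
  rw [cayley, add_sub_cancel, ← mul_assoc, (Commute.ofNat_right (1 + h) 2).eq, mul_assoc, hgeom,
    mul_one]

theorem one_add_cayley_mul_one_add : (1 + cayley h) * (1 + h) = 2 := by
  rw [← one_add_mul_one_add_cayley hlt]
  have hcomm : Commute h (1 + cayley h) := (Commute.one_right h).add_right (commute_cayley h)
  exact ((Commute.one_left _).add_left hcomm).symm.eq

theorem mul_one_add_cayley : h * (1 + cayley h) = 1 - cayley h := by
  have hinv := one_add_mul_one_add_cayley hlt
  rw [add_mul, one_mul, ← eq_sub_iff_add_eq'] at hinv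
  rw [hinv, ← one_add_one_eq_two]
  abel

theorem one_add_cayley_mul_mul_one_add_cayley :
    (1 + cayley h) * h * (1 + cayley h) = 1 - cayley h ^ 2 := by
  rw [mul_assoc, mul_one_add_cayley hlt]
  noncomm_ring

end Cayley

section Decay

theorem norm_pow_mul_pow_mul_le {R : Type*} [NormedRing R] {h r : R} (hcomm : Commute h r)
    (hr : ∀ k, ‖r ^ k‖ ≤ 1) (hhr : ∀ k : ℕ, ‖h * r ^ k‖ ^ 2 * (k + 1) ≤ 1) {m : ℕ} (hm : 0 < m)
    (k : ℕ) : ‖h ^ (2 * m) * r ^ k‖ * (k + 1) ^ m ≤ (2 * m) ^ m := by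
  set l := k / (2 * m)
  have hfactor : h ^ (2 * m) * r ^ k = (h * r ^ l) ^ (2 * m) * r ^ (k % (2 * m)) := by
    rw [(hcomm.pow_right l).mul_pow, ← pow_mul, mul_assoc, ← pow_add, mul_comm l,
      Nat.div_add_mod]
  have hnorm : ‖h ^ (2 * m) * r ^ k‖ ≤ (‖h * r ^ l‖ ^ 2) ^ m := by
    rw [hfactor, ← pow_mul]
    exact (norm_mul_le _ _).trans <|
      (mul_le_of_le_one_right (norm_nonneg _) (hr _)).trans (norm_pow_le' _ (by positivity))
  have hk : (k : ℝ) + 1 ≤ (l + 1) * (2 * m) := by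
    have : k + 1 ≤ (l + 1) * (2 * m) := by
      rw [mul_comm]; exact Nat.lt_mul_div_succ k (by positivity)
    exact_mod_cast this
  calc ‖h ^ (2 * m) * r ^ k‖ * (k + 1) ^ m
      ≤ (‖h * r ^ l‖ ^ 2) ^ m * ((l + 1) * (2 * m)) ^ m := by gcongr
    _ = (‖h * r ^ l‖ ^ 2 * (l + 1)) ^ m * (2 * m) ^ m := by simp only [mul_pow, mul_assoc]
    _ ≤ 1 ^ m * (2 * m) ^ m := by gcongr; exact hhr l
    _ = (2 * m) ^ m := by rw [one_pow, one_mul]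

end Decay

namespace IsPositiveOp

variable {A X : Type*} [NonUnitalCStarAlgebra A] [PartialOrder A]
  [NormedAddCommGroup X] [NormedSpace ℂ X] [SMul Aᵐᵒᵖ X] [CStarModule Aᵐᵒᵖ X]

theorem pow_odd {h : X →L[ℂ] X} (hh : IsPositiveOp A h) (n : ℕ) :
    IsPositiveOp A (h ^ (2 * n + 1)) := by
  refine ⟨hh.1.pow _, fun x => (hh.2 ((h ^ n) x)).trans_eq ?_⟩
  rw [hh.1.pow n]
  rw [two_mul, add_assoc, pow_add, pow_succ']
  rfl

variable [StarOrderedRing A] [CompleteSpace X] {h : X →L[ℂ] X} (hh : IsPositiveOp A h)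
  (hlt : ‖h‖ < 1)
include hh hlt

theorem isAdjoint_one_add_cayley : IsAdjoint A (1 + cayley h) (1 + cayley h) := by
  have hterm (n : ℕ) : IsAdjoint A (2 * (-h) ^ n) (2 * (-h) ^ n) := by
    rw [two_mul]
    exact (hh.1.neg.pow n).add (hh.1.neg.pow n)
  exact .hasSum hterm (hasSum_one_add_cayley hlt) (hasSum_one_add_cayley hlt)

theorem isAdjoint_cayley : IsAdjoint A (cayley h) (cayley h) := by
  simpa using (hh.isAdjoint_one_add_cayley hlt).sub .one

theorem rinner_sub_rinner_cayley (x : X) :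
    rinner A x x - rinner A (cayley h x) (cayley h x) =
      rinner A ((1 + cayley h) x) (h ((1 + cayley h) x)) := by
  rw [hh.isAdjoint_cayley hlt, ← rinner_sub_right, hh.isAdjoint_one_add_cayley hlt]
  refine congrArg (rinner A x) (.trans ?_
    (DFunLike.congr_fun (one_add_cayley_mul_mul_one_add_cayley hlt) x).symm)
  rw [sq]
  rfl

theorem norm_cayley_pow_le (n : ℕ) : ‖cayley h ^ n‖ ≤ 1 := by
  refine ContinuousLinearMap.opNorm_le_bound _ zero_le_one fun x => ?_
  rw [one_mul]
  induction n with
  | zero => simp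
  | succ n ih =>
    rw [pow_succ']
    refine (norm_le_of_rinner_le (A := A) ?_).trans ih
    exact sub_nonneg.1 ((hh.2 _).trans_eq (hh.rinner_sub_rinner_cayley hlt _).symm)

theorem norm_one_add_cayley_le : ‖1 + cayley h‖ ≤ 2 := by
  have h0 := hh.norm_cayley_pow_le hlt 0
  have h1 := hh.norm_cayley_pow_le hlt 1
  rw [pow_zero] at h0
  rw [pow_one] at h1
  exact (norm_add_le _ _).trans (by linarith)

theorem sum_rinner_one_add_cayley (x : X) (N : ℕ) :
    ∑ k ∈ Finset.range N, rinner A ((1 + cayley h) ((cayley h ^ k) x))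
      (h ((1 + cayley h) ((cayley h ^ k) x))) =
    rinner A x x - rinner A ((cayley h ^ N) x) ((cayley h ^ N) x) := by
  simp only [← hh.rinner_sub_rinner_cayley hlt]
  have htel := Finset.sum_range_sub'
    (fun k => rinner A ((cayley h ^ k) x) ((cayley h ^ k) x)) N
  simpa only [pow_succ', pow_zero, mul_apply_eq_comp, one_apply_eq_self] using htel

theorem antitone_rinner_one_add_cayley (x : X) :
    Antitone fun k : ℕ => rinner A ((1 + cayley h) ((cayley h ^ k) x))
      (h ((1 + cayley h) ((cayley h ^ k) x))) := by
  refine antitone_nat_of_succ_le fun k => ?_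
  simp only [← hh.rinner_sub_rinner_cayley hlt, pow_succ']
  change rinner A (cayley h ((cayley h ^ k) x)) (cayley h ((cayley h ^ k) x)) -
    rinner A (cayley h (cayley h ((cayley h ^ k) x))) (cayley h (cayley h ((cayley h ^ k) x))) ≤ _
  set z := (cayley h ^ k) x
  set r := cayley h
  have hr : IsAdjoint A r r := hh.isAdjoint_cayley hlt
  have hsq : rinner A (r (r z)) z = rinner A (r z) (r z) := hr (r z) z
  -- The difference of consecutive terms is `⟨(1 - r²) z, (1 - r²) z⟩`.
  refine sub_nonneg.1 ((rinner_self_nonneg (A := A) (z - r (r z))).trans_eq ?_)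
  rw [rinner_sub_right, ← star_rinner z, ← star_rinner (r (r z)) (z - _), rinner_sub_right,
    rinner_sub_right, star_sub, star_sub]
  simp only [star_rinner, hsq, ← hr z (r z)]

theorem nsmul_rinner_one_add_cayley_le (x : X) (k : ℕ) :
    (k + 1) • rinner A ((1 + cayley h) ((cayley h ^ k) x))
      (h ((1 + cayley h) ((cayley h ^ k) x))) ≤ rinner A x x := by
  have hcard := Finset.card_nsmul_le_sum (Finset.range (k + 1)) _ _ fun j hj =>
    hh.antitone_rinner_one_add_cayley hlt x (Nat.lt_succ_iff.1 (Finset.mem_range.1 hj))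
  rw [Finset.card_range, hh.sum_rinner_one_add_cayley hlt] at hcard
  exact hcard.trans (sub_le_self _ (rinner_self_nonneg _))

theorem norm_rinner_cayley_pow_mul_le (x : X) (k : ℕ) :
    ‖rinner A ((cayley h ^ k) x) (h ((cayley h ^ k) x))‖ * (k + 1) ≤ ‖x‖ ^ 2 := by
  -- `(1 + r)⁻¹ = (1 + h) / 2` is a contraction.
  set y := (2 : ℂ)⁻¹ • (1 + h) x
  have hy : (1 + cayley h) ((cayley h ^ k) y) = (cayley h ^ k) x := by
    have hcomm : Commute (1 + cayley h) (cayley h ^ k) :=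
      (Commute.one_left _).add_left (Commute.refl _ |>.pow_right k)
    have hinv : (1 + cayley h) ((1 + h) x) = (2 : ℂ) • x := by
      rw [two_smul]
      simpa [← one_add_one_eq_two] using DFunLike.congr_fun (one_add_cayley_mul_one_add hlt) x
    change ((1 + cayley h) * cayley h ^ k) y = _
    rw [hcomm.eq]
    change (cayley h ^ k) ((1 + cayley h) y) = _
    rw [map_smul, hinv, smul_smul, inv_mul_cancel₀ two_ne_zero, one_smul]
  have hyx : ‖y‖ ≤ ‖x‖ := by
    rw [norm_smul, norm_inv, Complex.norm_ofNat, inv_mul_le_iff₀ two_pos, two_mul]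
    refine (norm_add_le _ _).trans (add_le_add le_rfl ?_)
    exact ((h.le_opNorm x).trans (mul_le_of_le_one_left (norm_nonneg _) hlt.le))
  have hle := hh.nsmul_rinner_one_add_cayley_le hlt y k
  rw [hy] at hle
  have hnorm := CStarAlgebra.norm_le_norm_of_nonneg_of_le (nsmul_nonneg (hh.2 _) _) hle
  rw [← norm_sq_eq_rinner, ← Nat.cast_smul_eq_nsmul ℝ, norm_smul, Real.norm_natCast,
    Nat.cast_succ, mul_comm] at hnorm
  exact hnorm.trans (by gcongr)

end IsPositiveOp

section SmallFamily

variable (A : Type*) {X : Type*} [NonUnitalCStarAlgebra A] [PartialOrder A]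
  [NormedAddCommGroup X] [NormedSpace ℂ X] [SMul Aᵐᵒᵖ X] [CStarModule Aᵐᵒᵖ X]

/-- A sequence of vectors with `∑ ‖ξ_i‖ < 1`, so that its frame operator has norm less than one. -/
structure IsSmallFamily (ξ : ℕ → X) : Prop where
  summable : Summable fun i => ‖ξ i‖
  tsum_lt_one : ∑' i, ‖ξ i‖ < 1

variable [StarOrderedRing A]

/-- The frame operator `x ↦ ∑ ξ_i ⟨ξ_i, x⟩` of a sequence of vectors. -/
noncomputable def frameOp (ξ : ℕ → X) : X →L[ℂ] X := ∑' i, rankOne A (ξ i) (ξ i)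

namespace IsSmallFamily

variable {A} {ξ : ℕ → X} (hξ : IsSmallFamily ξ)
include hξ

theorem norm_rankOne_le_norm (i : ℕ) : ‖rankOne A (ξ i) (ξ i)‖ ≤ ‖ξ i‖ :=
  (norm_rankOne_le _ _).trans <| mul_le_of_le_one_left (norm_nonneg _) <|
    (hξ.summable.le_tsum i fun _ _ => norm_nonneg _).trans hξ.tsum_lt_one.le

theorem norm_frameOp_lt_one : ‖frameOp A ξ‖ < 1 :=
  (tsum_of_norm_bounded hξ.summable.hasSum hξ.norm_rankOne_le_norm).trans_lt hξ.tsum_lt_one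

theorem norm_frameOp_pow_le_one (p : ℕ) : ‖frameOp A ξ ^ p‖ ≤ 1 := by
  cases p with
  | zero => exact ContinuousLinearMap.norm_id_le
  | succ p =>
    exact (norm_pow_le' _ p.succ_pos).trans
      (pow_le_one₀ (norm_nonneg _) hξ.norm_frameOp_lt_one.le)

variable [CompleteSpace X]

theorem hasSum_frameOp : HasSum (fun i => rankOne A (ξ i) (ξ i)) (frameOp A ξ) :=
  (Summable.of_norm_bounded hξ.summable hξ.norm_rankOne_le_norm).hasSum

theorem frameOp_mem_compactOps : frameOp A ξ ∈ compactOps A :=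
  mem_closure_of_tendsto hξ.hasSum_frameOp <| Eventually.of_forall fun _ =>
    Submodule.sum_mem _ fun i _ => Submodule.subset_span (isRankOne_rankOne (ξ i) (ξ i))

theorem hasSum_frameOp_apply (x : X) :
    HasSum (fun i => ξ i <• rinner A (ξ i) x) (frameOp A ξ x) := by
  simpa only [ContinuousLinearMap.apply_apply, rankOne_apply] using
    (ContinuousLinearMap.apply ℂ X x).hasSum (hξ.hasSum_frameOp (A := A))

theorem hasSum_rinner_frameOp (x y : X) :
    HasSum (fun i => rinner A x (ξ i) * rinner A (ξ i) y) (rinner A x (frameOp A ξ y)) := by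
  simpa only [rinnerCLM_apply, rinner_smul_right] using
    (rinnerCLM A x).hasSum (hξ.hasSum_frameOp_apply (A := A) y)

theorem hasSum_star_mul_self_frameOp (x : X) :
    HasSum (fun i => star (rinner A (ξ i) x) * rinner A (ξ i) x)
      (rinner A x (frameOp A ξ x)) := by
  simpa only [star_rinner] using hξ.hasSum_rinner_frameOp x x

theorem isPositiveOp_frameOp : IsPositiveOp A (frameOp A ξ) :=
  ⟨.hasSum (fun i => .rankOne (ξ i) (ξ i)) hξ.hasSum_frameOp hξ.hasSum_frameOp, fun x =>
    (hξ.hasSum_star_mul_self_frameOp x).nonneg fun _ => star_mul_self_nonneg _⟩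

theorem frameOp_pow_succ_mem_compactOps (n : ℕ) : frameOp A ξ ^ (n + 1) ∈ compactOps A := by
  rw [pow_succ]
  exact comp_mem_compactOps (hξ.isPositiveOp_frameOp.1.pow n) .one hξ.frameOp_mem_compactOps

theorem norm_rinner_cayley_pow_sq_mul_le (x : X) (i k : ℕ) :
    ‖rinner A (ξ i) ((cayley (frameOp A ξ) ^ k) x)‖ ^ 2 * (k + 1) ≤ ‖x‖ ^ 2 := by
  set y := (cayley (frameOp A ξ) ^ k) x
  have hy : ‖rinner A (ξ i) y‖ ^ 2 ≤ ‖rinner A y (frameOp A ξ y)‖ := by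
    rw [sq, ← CStarRing.norm_star_mul_self]
    exact CStarAlgebra.norm_le_norm_of_nonneg_of_le (star_mul_self_nonneg _)
      (le_hasSum (hξ.hasSum_star_mul_self_frameOp y) i fun _ _ => star_mul_self_nonneg _)
  exact (mul_le_mul_of_nonneg_right hy (by positivity)).trans
    (hξ.isPositiveOp_frameOp.norm_rinner_cayley_pow_mul_le hξ.norm_frameOp_lt_one x k)

theorem norm_frameOp_mul_cayley_pow_sq_mul_le (k : ℕ) :
    ‖frameOp A ξ * cayley (frameOp A ξ) ^ k‖ ^ 2 * (k + 1) ≤ 1 := by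
  have hk : (0 : ℝ) < k + 1 := by positivity
  rw [← le_div_iff₀ hk, ← Real.sqrt_le_sqrt_iff (by positivity), Real.sqrt_sq (norm_nonneg _)]
  refine ContinuousLinearMap.opNorm_le_bound _ (by positivity) fun x => ?_
  refine ((hξ.hasSum_frameOp_apply (A := A) ((cayley (frameOp A ξ) ^ k) x)).norm_le_of_bounded
    (hξ.summable.hasSum.mul_right (√(1 / (k + 1)) * ‖x‖)) fun i => ?_).trans
    (mul_le_of_le_one_left (by positivity) hξ.tsum_lt_one.le)
  refine (norm_op_smul_le _ _).trans (mul_le_mul_of_nonneg_left ?_ (norm_nonneg _))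
  rw [← Real.sqrt_sq (norm_nonneg x), ← Real.sqrt_mul (by positivity), one_div_mul_eq_div]
  exact Real.le_sqrt_of_sq_le <|
    (le_div_iff₀ hk).2 (hξ.norm_rinner_cayley_pow_sq_mul_le x i k)

theorem norm_frameOp_pow_mul_cayley_pow_mul_le {m : ℕ} (hm : 0 < m) (k : ℕ) :
    ‖frameOp A ξ ^ (2 * m) * cayley (frameOp A ξ) ^ k‖ * (k + 1) ^ m ≤ (2 * m) ^ m :=
  norm_pow_mul_pow_mul_le (commute_cayley _)
    (hξ.isPositiveOp_frameOp.norm_cayley_pow_le (A := A) hξ.norm_frameOp_lt_one)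
    hξ.norm_frameOp_mul_cayley_pow_sq_mul_le hm k

theorem norm_frameOp_pow_mul_cayley_pow_le (p n : ℕ) :
    ‖frameOp A ξ ^ p * cayley (frameOp A ξ) ^ n‖ ≤ 1 :=
  (norm_mul_le _ _).trans <| mul_le_one₀ (hξ.norm_frameOp_pow_le_one p) (norm_nonneg _)
    (hξ.isPositiveOp_frameOp.norm_cayley_pow_le (A := A) hξ.norm_frameOp_lt_one n)

theorem norm_cayley_pow_apply_sq_mul_le (i k : ℕ) :
    ‖(cayley (frameOp A ξ) ^ k) (ξ i)‖ ^ 2 * (k + 1) ≤ 1 := by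
  have hr := hξ.isPositiveOp_frameOp.isAdjoint_cayley (A := A) hξ.norm_frameOp_lt_one
  set y := (cayley (frameOp A ξ) ^ k) (ξ i) with hy
  have hle := hξ.norm_rinner_cayley_pow_sq_mul_le (A := A) y i k
  rw [← hr.pow k, ← hy, ← norm_sq_eq_rinner] at hle
  rcases (norm_nonneg y).eq_or_lt with h0 | h0
  · simp [← h0]
  · exact le_of_mul_le_mul_left (by linarith) (pow_pos h0 2)

variable (hd : Dense (rightSpan A ξ))
include hd

theorem tendsto_cayley_pow (x : X) :
    Tendsto (fun k => (cayley (frameOp A ξ) ^ k) x) atTop (𝓝 0) := by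
  have hpos := hξ.isPositiveOp_frameOp (A := A)
  have hr := hpos.isAdjoint_cayley hξ.norm_frameOp_lt_one
  have hξi (i : ℕ) : Tendsto (fun k => (cayley (frameOp A ξ) ^ k) (ξ i)) atTop (𝓝 0) := by
    have hsq : Tendsto (fun k => ‖(cayley (frameOp A ξ) ^ k) (ξ i)‖ ^ 2) atTop (𝓝 0) := by
      refine squeeze_zero (fun _ => by positivity) (fun k => ?_)
        tendsto_one_div_add_atTop_nhds_zero_nat
      exact (le_div_iff₀ (by positivity)).2 (hξ.norm_cayley_pow_apply_sq_mul_le i k)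
    rw [tendsto_zero_iff_norm_tendsto_zero]
    simpa using hsq.sqrt
  have hspan : ∀ y ∈ rightSpan A ξ,
      Tendsto (fun k => (cayley (frameOp A ξ) ^ k) y) atTop (𝓝 0) := by
    rintro _ ⟨N, a, rfl⟩
    simp only [map_sum, (hr.pow _).map_op_smul]
    rw [← Finset.sum_const_zero (s := Finset.range N)]
    refine tendsto_finsetSum _ fun i _ => squeeze_zero_norm (fun k => norm_op_smul_le _ _) ?_
    simpa using (hξi i).norm.mul_const ‖a i‖
  refine Metric.tendsto_atTop.2 fun ε hε => ?_
  obtain ⟨y, hxy, hy⟩ := Metric.dense_iff.1 hd x (ε / 2) (by positivity)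
  obtain ⟨N, hN⟩ := Metric.tendsto_atTop.1 (hspan y hy) (ε / 2) (by positivity)
  refine ⟨N, fun k hk => ?_⟩
  have hyk := hN k hk
  rw [dist_zero_right] at hyk ⊢
  rw [Metric.mem_ball, dist_eq_norm, norm_sub_rev] at hxy
  have hcontr := ((cayley (frameOp A ξ) ^ k).le_opNorm (x - y)).trans
    (mul_le_of_le_one_left (norm_nonneg _) (hpos.norm_cayley_pow_le hξ.norm_frameOp_lt_one k))
  calc ‖(cayley (frameOp A ξ) ^ k) x‖
      = ‖(cayley (frameOp A ξ) ^ k) (x - y) + (cayley (frameOp A ξ) ^ k) y‖ := by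
        rw [← map_add, sub_add_cancel]
    _ ≤ _ := norm_add_le _ _
    _ < ε := by linarith

theorem denseRange_frameOp_pow (n : ℕ) : DenseRange (frameOp A ξ ^ n) := by
  have hdense : DenseRange (frameOp A ξ) := fun x => by
    have hlim : Tendsto (fun k => x - (cayley (frameOp A ξ) ^ k) x) atTop (𝓝 x) := by
      simpa using tendsto_const_nhds.sub (hξ.tendsto_cayley_pow hd x)
    refine mem_closure_of_tendsto hlim (Eventually.of_forall fun k => ?_)
    -- `1 - r ^ k` is a multiple of `1 - r = h (1 + r)`.
    have hgeom := mul_neg_geom_sum (cayley (frameOp A ξ)) k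
    rw [← mul_one_add_cayley hξ.norm_frameOp_lt_one, mul_assoc] at hgeom
    exact ⟨_, DFunLike.congr_fun hgeom x⟩
  induction n with
  | zero => exact Function.surjective_id.denseRange
  | succ n ih => rw [pow_succ']; exact hdense.comp ih (frameOp A ξ).continuous

theorem hasSum_rinner_one_add_cayley (x : X) :
    HasSum (fun k : ℕ => rinner A ((1 + cayley (frameOp A ξ)) ((cayley (frameOp A ξ) ^ k) x))
      (frameOp A ξ ((1 + cayley (frameOp A ξ)) ((cayley (frameOp A ξ) ^ k) x))))
      (rinner A x x) := by
  have hpos := hξ.isPositiveOp_frameOp (A := A)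
  refine hasSum_of_tendsto_sum_range_of_nonneg (fun k => hpos.2 _) ?_
  simp only [hpos.sum_rinner_one_add_cayley hξ.norm_frameOp_lt_one]
  have hsq := (hξ.tendsto_cayley_pow hd x).norm.pow 2
  simp only [norm_sq_eq_rinner (A := A), norm_zero, zero_pow two_ne_zero] at hsq
  simpa using tendsto_const_nhds.sub (tendsto_zero_iff_norm_tendsto_zero.2 hsq)

theorem isParsevalFrame : IsParsevalFrame A fun n =>
    (1 + cayley (frameOp A ξ)) ((cayley (frameOp A ξ) ^ n.unpair.2) (ξ n.unpair.1)) := fun x => by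
  have hpos := hξ.isPositiveOp_frameOp (A := A)
  have hlt := hξ.norm_frameOp_lt_one (A := A)
  set r := cayley (frameOp A ξ)
  have hcoeff (i k : ℕ) : rinner A ((1 + r) ((r ^ k) (ξ i))) x =
      rinner A (ξ i) ((1 + r) ((r ^ k) x)) := by
    have hcomm : Commute (1 + r) (r ^ k) :=
      (Commute.one_left _).add_left ((Commute.refl r).pow_right k)
    rw [hpos.isAdjoint_one_add_cayley hlt, (hpos.isAdjoint_cayley hlt).pow k]
    exact congrArg _ (DFunLike.congr_fun hcomm.eq x).symm
  have hrows (k : ℕ) := hξ.hasSum_star_mul_self_frameOp (A := A) ((1 + r) ((r ^ k) x))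
  have hprod := hasSum_prod_of_nonneg
    (f := fun p => star (rinner A (ξ p.1) ((1 + r) ((r ^ p.2) x))) *
      rinner A (ξ p.1) ((1 + r) ((r ^ p.2) x)))
    (fun _ => star_mul_self_nonneg _) hrows (hξ.hasSum_rinner_one_add_cayley hd x)
  have hseq := Nat.pairEquiv.symm.hasSum_iff.2 hprod
  simpa only [hcoeff, Function.comp_def, Nat.pairEquiv_symm_apply] using hseq

end IsSmallFamily

end SmallFamily

open scoped BoundedContinuousFunction

/-- Weights `w_i > 0` with `∑ w_i < 1`. -/
structure IsWeight (w : ℕ → ℝ) : Prop where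
  pos : ∀ i, 0 < w i
  summable : Summable w
  tsum_lt_one : ∑' i, w i < 1

namespace IsWeight

variable {w : ℕ → ℝ} (hw : IsWeight w)
include hw

theorem sq_le (i : ℕ) : w i ^ 2 ≤ w i := by
  have hle : w i ≤ 1 := (hw.summable.le_tsum i fun j _ => (hw.pos j).le).trans hw.tsum_lt_one.le
  exact (pow_le_pow_of_le_one (hw.pos i).le hle one_le_two).trans_eq (pow_one _)

theorem summable_sq : Summable fun i => w i ^ 2 :=
  .of_nonneg_of_le (fun _ => by positivity) hw.sq_le hw.summable

theorem tsum_sq_lt_one : ∑' i, w i ^ 2 < 1 :=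
  (hw.summable_sq.tsum_le_tsum hw.sq_le hw.summable).trans_lt hw.tsum_lt_one

end IsWeight

section WeightedMul

variable {B : Type*} [NonUnitalNormedRing B] [NormedSpace ℂ B]

theorem norm_weighted_mul_le (w : ℕ → ℝ) (D E : ℕ × ℕ →ᵇ B) (i j m : ℕ) :
    ‖(w m : ℂ) ^ 2 • (D (i, m) * E (m, j))‖ ≤ w m ^ 2 * (‖D‖ * ‖E‖) := by
  rw [norm_smul, norm_pow, Complex.norm_real, Real.norm_eq_abs, sq_abs]
  exact mul_le_mul_of_nonneg_left ((norm_mul_le _ _).trans (mul_le_mul (D.norm_coe_le_norm _)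
    (E.norm_coe_le_norm _) (norm_nonneg _) (norm_nonneg _))) (by positivity)

variable [CompleteSpace B] {w : ℕ → ℝ} (hw : IsWeight w)

include hw in
theorem IsWeight.summable_mul (D E : ℕ × ℕ →ᵇ B) (i j : ℕ) :
    Summable fun m => (w m : ℂ) ^ 2 • (D (i, m) * E (m, j)) :=
  .of_norm_bounded (hw.summable_sq.mul_right _) (norm_weighted_mul_le w D E i j)

variable [IsScalarTower ℂ B B] [SMulCommClass ℂ B B]

/-- The product `(D ⋆ E)_ij = ∑ w_m² D_im E_mj` of bounded infinite matrices. -/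
noncomputable def weightedMul : (ℕ × ℕ →ᵇ B) →L[ℂ] (ℕ × ℕ →ᵇ B) →L[ℂ] (ℕ × ℕ →ᵇ B) :=
  LinearMap.mkContinuous₂
    (LinearMap.mk₂ ℂ (fun D E => BoundedContinuousFunction.ofNormedAddCommGroupDiscrete
        (fun p => ∑' m, (w m : ℂ) ^ 2 • (D (p.1, m) * E (m, p.2)))
        ((∑' m, w m ^ 2) * (‖D‖ * ‖E‖)) fun p =>
          tsum_of_norm_bounded (hw.summable_sq.hasSum.mul_right _)
            (norm_weighted_mul_le w D E p.1 p.2))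
      (fun D D' E => by
        ext p
        simp [add_mul, (hw.summable_mul D E p.1 p.2).tsum_add (hw.summable_mul D' E p.1 p.2)])
      (fun c D E => by
        ext p
        simp [smul_mul_assoc, smul_comm _ c, (hw.summable_mul D E p.1 p.2).tsum_const_smul])
      (fun D E E' => by
        ext p
        simp [mul_add, (hw.summable_mul D E p.1 p.2).tsum_add (hw.summable_mul D E' p.1 p.2)])
      (fun c D E => by
        ext p
        simp [mul_smul_comm, smul_comm _ c, (hw.summable_mul D E p.1 p.2).tsum_const_smul]))
    (∑' m, w m ^ 2) fun D E => by
      rw [mul_assoc]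
      exact (BoundedContinuousFunction.norm_le
        (mul_nonneg (tsum_nonneg fun _ => sq_nonneg _) (by positivity))).2 fun p =>
          tsum_of_norm_bounded (hw.summable_sq.hasSum.mul_right _)
            (norm_weighted_mul_le w D E p.1 p.2)

theorem weightedMul_apply (D E : ℕ × ℕ →ᵇ B) (i j : ℕ) :
    weightedMul hw D E (i, j) = ∑' m, (w m : ℂ) ^ 2 • (D (i, m) * E (m, j)) := rfl

theorem norm_weightedMul_le (D E : ℕ × ℕ →ᵇ B) :
    ‖weightedMul hw D E‖ ≤ (∑' m, w m ^ 2) * (‖D‖ * ‖E‖) := by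
  refine (BoundedContinuousFunction.norm_le (by positivity)).2 fun p => ?_
  rw [← p.eta, weightedMul_apply]
  exact tsum_of_norm_bounded (hw.summable_sq.hasSum.mul_right _)
    (norm_weighted_mul_le w D E p.1 p.2)

theorem norm_weightedMul_le_mul (D E : ℕ × ℕ →ᵇ B) : ‖weightedMul hw D E‖ ≤ ‖D‖ * ‖E‖ :=
  (norm_weightedMul_le hw D E).trans <|
    mul_le_of_le_one_left (by positivity) hw.tsum_sq_lt_one.le

theorem weightedMul_assoc (D E F : ℕ × ℕ →ᵇ B) :
    weightedMul hw (weightedMul hw D E) F = weightedMul hw D (weightedMul hw E F) := by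
  ext ⟨i, j⟩
  have hsum : Summable fun p : ℕ × ℕ =>
      (w p.1 : ℂ) ^ 2 • (w p.2 : ℂ) ^ 2 • (D (i, p.2) * E (p.2, p.1) * F (p.1, j)) := by
    refine .of_norm_bounded ((hw.summable_sq.mul_of_nonneg hw.summable_sq (fun _ => sq_nonneg _)
      fun _ => sq_nonneg _).mul_right (‖D‖ * ‖E‖ * ‖F‖)) fun p => ?_
    rw [norm_smul, norm_smul, ← mul_assoc]
    simp only [norm_pow, Complex.norm_real, Real.norm_eq_abs, sq_abs]
    gcongr
    exact (norm_mul_le _ _).trans (mul_le_mul ((norm_mul_le _ _).trans (mul_le_mul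
      (D.norm_coe_le_norm _) (E.norm_coe_le_norm _) (norm_nonneg _) (norm_nonneg _)))
      (F.norm_coe_le_norm _) (norm_nonneg _) (by positivity))
  have hleft (m : ℕ) : (w m : ℂ) ^ 2 • ((∑' l, (w l : ℂ) ^ 2 • (D (i, l) * E (l, m))) * F (m, j)) =
      ∑' l, (w m : ℂ) ^ 2 • (w l : ℂ) ^ 2 • (D (i, l) * E (l, m) * F (m, j)) := by
    rw [← (hw.summable_mul D E i m).tsum_mul_right,
      ← ((hw.summable_mul D E i m).mul_right _).tsum_const_smul]
    simp only [smul_mul_assoc]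
  have hright (l : ℕ) : (w l : ℂ) ^ 2 • (D (i, l) * ∑' m, (w m : ℂ) ^ 2 • (E (l, m) * F (m, j))) =
      ∑' m, (w m : ℂ) ^ 2 • (w l : ℂ) ^ 2 • (D (i, l) * E (l, m) * F (m, j)) := by
    rw [← (hw.summable_mul E F l j).tsum_mul_left,
      ← ((hw.summable_mul E F l j).mul_left _).tsum_const_smul]
    simp only [mul_smul_comm, mul_assoc, smul_comm ((w l : ℂ) ^ 2)]
  simp only [weightedMul_apply, hleft, hright]
  exact (Summable.tsum_comm (f := fun m l =>
    (w m : ℂ) ^ 2 • (w l : ℂ) ^ 2 • (D (i, l) * E (l, m) * F (m, j))) hsum).symm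

end WeightedMul

section CoeffMatrix

variable {A B X : Type*} [NonUnitalCStarAlgebra A] [PartialOrder A] [StarOrderedRing A]
  [NonUnitalCStarAlgebra B] [NormedAddCommGroup X] [NormedSpace ℂ X] [SMul Aᵐᵒᵖ X]
  [CStarModule Aᵐᵒᵖ X]

theorem norm_rinner_apply_le {η : ℕ → X} (hη : ∀ i, ‖η i‖ ≤ 1) (Q : X →L[ℂ] X) (i j : ℕ) :
    ‖rinner A (η i) (Q (η j))‖ ≤ ‖Q‖ := by
  calc ‖rinner A (η i) (Q (η j))‖ ≤ ‖η i‖ * ‖Q (η j)‖ := norm_rinner_le _ _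
    _ ≤ 1 * (‖Q‖ * 1) := by
        gcongr
        exacts [hη i, Q.le_opNorm_of_le (hη j)]
    _ = ‖Q‖ := by ring

open scoped CStarAlgebra in
/-- The matrix over `B` with entries `ρ ⟨η_i, Q η_j⟩`. -/
noncomputable def coeffMat (ρ : A →⋆ₙₐ[ℂ] B) {η : ℕ → X} (hη : ∀ i, ‖η i‖ ≤ 1) :
    (X →L[ℂ] X) →ₗ[ℂ] (ℕ × ℕ →ᵇ B) where
  toFun Q := BoundedContinuousFunction.ofNormedAddCommGroupDiscrete
    (fun p => ρ (rinner A (η p.1) (Q (η p.2)))) ‖Q‖ fun p =>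
      (NonUnitalStarAlgHom.norm_apply_le ρ _).trans (norm_rinner_apply_le hη Q p.1 p.2)
  map_add' Q Q' := by ext p; simp [rinner_add_right]
  map_smul' c Q := by ext p; simp [rinner_smul_complex_right]

variable (ρ : A →⋆ₙₐ[ℂ] B) {η : ℕ → X} (hη : ∀ i, ‖η i‖ ≤ 1)

theorem coeffMat_apply (Q : X →L[ℂ] X) (i j : ℕ) :
    coeffMat ρ hη Q (i, j) = ρ (rinner A (η i) (Q (η j))) := rfl

open scoped CStarAlgebra in
theorem norm_coeffMat_le (Q : X →L[ℂ] X) : ‖coeffMat ρ hη Q‖ ≤ ‖Q‖ :=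
  (BoundedContinuousFunction.norm_le (norm_nonneg _)).2 fun p =>
    (NonUnitalStarAlgHom.norm_apply_le ρ _).trans (norm_rinner_apply_le hη Q p.1 p.2)

end CoeffMatrix

section Weighted

variable {A X : Type*} [NonUnitalCStarAlgebra A] [PartialOrder A]
  [NormedAddCommGroup X] [NormedSpace ℂ X] [SMul Aᵐᵒᵖ X] [CStarModule Aᵐᵒᵖ X]

/-- The rescaled family `w_i η_i`. -/
noncomputable def weighted (w : ℕ → ℝ) (η : ℕ → X) (i : ℕ) : X := (w i : ℂ) • η i

variable {w : ℕ → ℝ} (hw : IsWeight w) {η : ℕ → X} (hη : ∀ i, ‖η i‖ ≤ 1)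
include hw hη

theorem norm_weighted_le (i : ℕ) : ‖weighted w η i‖ ≤ w i := by
  rw [weighted, norm_smul, Complex.norm_real, Real.norm_of_nonneg (hw.pos i).le]
  exact mul_le_of_le_one_right (hw.pos i).le (hη i)

theorem isSmallFamily_weighted : IsSmallFamily (weighted w η) := by
  have hsum : Summable fun i => ‖weighted w η i‖ :=
    .of_nonneg_of_le (fun _ => norm_nonneg _) (norm_weighted_le hw hη) hw.summable
  exact ⟨hsum, (hsum.tsum_le_tsum (norm_weighted_le hw hη) hw.summable).trans_lt hw.tsum_lt_one⟩

variable [StarOrderedRing A]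

theorem norm_frameOp_weighted_le : ‖frameOp A (weighted w η)‖ ≤ ∑' i, w i ^ 2 := by
  refine tsum_of_norm_bounded hw.summable_sq.hasSum fun i => (norm_rankOne_le _ _).trans ?_
  rw [sq]
  have hle := norm_weighted_le hw hη i
  exact mul_le_mul hle hle (norm_nonneg _) (hw.pos i).le

theorem hasSum_rinner_apply_frameOp_weighted [CompleteSpace X] {Q Q' : X →L[ℂ] X}
    (hQ : IsAdjoint A Q Q') (x y : X) :
    HasSum (fun m => (w m : ℂ) ^ 2 • (rinner A x (Q (η m)) * rinner A (η m) y))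
      (rinner A x (Q (frameOp A (weighted w η) y))) := by
  have hsum := (isSmallFamily_weighted hw hη).hasSum_rinner_frameOp (A := A) (Q' x) y
  have hQ' (x y : X) : rinner A (Q' x) y = rinner A x (Q y) := hQ.symm x y
  simpa only [hQ', weighted, map_smul, rinner_smul_complex_right, rinner_smul_complex_left,
    Complex.star_def, Complex.conj_ofReal, smul_mul_smul_comm, ← sq] using hsum

end Weighted

section CoeffMatrixMul

variable {A B X : Type*} [NonUnitalCStarAlgebra A] [PartialOrder A] [StarOrderedRing A]
  [NonUnitalCStarAlgebra B] [NormedAddCommGroup X] [NormedSpace ℂ X] [SMul Aᵐᵒᵖ X]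
  [CStarModule Aᵐᵒᵖ X] (ρ : A →⋆ₙₐ[ℂ] B) {w : ℕ → ℝ} (hw : IsWeight w) {η : ℕ → X}
  (hη : ∀ i, ‖η i‖ ≤ 1)

theorem norm_weightedMul_add_le (P Q : X →L[ℂ] X) (D E : ℕ × ℕ →ᵇ B) :
    ‖weightedMul hw D (coeffMat ρ hη Q) + weightedMul hw (coeffMat ρ hη P) E‖ ≤
      (∑' m, w m ^ 2) * (‖D‖ * ‖Q‖ + ‖P‖ * ‖E‖) := by
  have : 0 ≤ ∑' m, w m ^ 2 := tsum_nonneg fun _ => sq_nonneg _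
  rw [mul_add]
  refine norm_add_le_of_le ((norm_weightedMul_le hw _ _).trans ?_)
    ((norm_weightedMul_le hw _ _).trans ?_)
  · have := norm_coeffMat_le ρ hη Q
    gcongr
  · have := norm_coeffMat_le ρ hη P
    gcongr

theorem norm_weightedMul_add_le_add (P Q : X →L[ℂ] X) (D E : ℕ × ℕ →ᵇ B) :
    ‖weightedMul hw D (coeffMat ρ hη Q) + weightedMul hw (coeffMat ρ hη P) E‖ ≤
      ‖D‖ * ‖Q‖ + ‖P‖ * ‖E‖ :=
  (norm_weightedMul_add_le ρ hw hη P Q D E).trans <|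
    mul_le_of_le_one_left (by positivity) hw.tsum_sq_lt_one.le

open scoped CStarAlgebra in
theorem coeffMat_mul_frameOp_mul [CompleteSpace X] {P P' : X →L[ℂ] X} (hP : IsAdjoint A P P')
    (Q : X →L[ℂ] X) : coeffMat ρ hη (P * frameOp A (weighted w η) * Q) =
      weightedMul hw (coeffMat ρ hη P) (coeffMat ρ hη Q) := by
  ext ⟨i, j⟩
  have hsum := (hasSum_rinner_apply_frameOp_weighted hw hη hP (η i) (Q (η j))).map ρ
    (map_continuous ρ)
  simp only [Function.comp_def, map_smul, map_mul, ← coeffMat_apply ρ hη] at hsum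
  exact hsum.tsum_eq.symm

end CoeffMatrixMul

section DerivGraph

variable {A B X : Type*} [NonUnitalCStarAlgebra A] [PartialOrder A] [StarOrderedRing A]
  [NonUnitalCStarAlgebra B] [NormedAddCommGroup X] [NormedSpace ℂ X] [SMul Aᵐᵒᵖ X]
  [CStarModule Aᵐᵒᵖ X] {𝒜 : NonUnitalStarSubalgebra ℂ A}

/-- The pairs `(Q, D)` of an operator `Q` and a bounded matrix `D` such that the entries `D_ij`
are derivatives of the matrix coefficients `⟨η_i, Q η_j⟩`. -/
noncomputable def derivGraph (δ : 𝒜 →ₗ[ℂ] B) (η : ℕ → X) :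
    Submodule ℂ ((X →L[ℂ] X) × (ℕ × ℕ →ᵇ B)) :=
  ⨅ p : ℕ × ℕ, (graphClosure δ).comap
    (((rinnerCLM A (η p.1) ∘L ContinuousLinearMap.apply ℂ X (η p.2)).prodMap
      (BoundedContinuousFunction.evalCLM ℂ p)).toLinearMap)

theorem mem_derivGraph {δ : 𝒜 →ₗ[ℂ] B} {η : ℕ → X} {Q : X →L[ℂ] X} {D : ℕ × ℕ →ᵇ B} :
    (Q, D) ∈ derivGraph δ η ↔ ∀ i j, (rinner A (η i) (Q (η j)), D (i, j)) ∈ graphClosure δ := by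
  simp [derivGraph, Submodule.mem_iInf]

theorem isClosed_derivGraph (δ : 𝒜 →ₗ[ℂ] B) (η : ℕ → X) :
    IsClosed (derivGraph δ η : Set ((X →L[ℂ] X) × (ℕ × ℕ →ᵇ B))) := by
  rw [derivGraph, Submodule.coe_iInf]
  exact isClosed_iInter fun p =>
    (isClosed_graphClosure δ).preimage (ContinuousLinearMap.continuous _)

variable {ρ : A →⋆ₙₐ[ℂ] B} {δ : 𝒜 →ₗ[ℂ] B} (hδ : IsDerivationAlong ρ δ)
  {w : ℕ → ℝ} (hw : IsWeight w) {η : ℕ → X} (hη : ∀ i, ‖η i‖ ≤ 1)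
include hδ

open scoped CStarAlgebra in
theorem mul_frameOp_mul_mem_derivGraph [CompleteSpace X] {P P' Q : X →L[ℂ] X}
    {D E : ℕ × ℕ →ᵇ B} (hP : IsAdjoint A P P') (hD : (P, D) ∈ derivGraph δ η)
    (hE : (Q, E) ∈ derivGraph δ η) :
    (P * frameOp A (weighted w η) * Q,
      weightedMul hw D (coeffMat ρ hη Q) + weightedMul hw (coeffMat ρ hη P) E) ∈
        derivGraph δ η := by
  rw [mem_derivGraph] at hD hE ⊢
  intro i j
  refine hasSum_mem_graphClosure (fun m => (graphClosure δ).smul_mem ((w m : ℂ) ^ 2)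
    (hδ.mul_mem_graphClosure (hD i m) (hE m j)))
    (hasSum_rinner_apply_frameOp_weighted hw hη hP (η i) (Q (η j))) ?_
  rw [BoundedContinuousFunction.add_apply, weightedMul_apply, weightedMul_apply]
  simp only [smul_add, ← coeffMat_apply ρ hη]
  exact (hw.summable_mul D _ i j).hasSum.add (hw.summable_mul _ E i j).hasSum

end DerivGraph

theorem norm_le_of_recurrence {V : Type*} [NormedAddCommGroup V] [NormedSpace ℂ V]
    {T : V →L[ℂ] V} (hT : ∀ (n : ℕ) (v : V), ‖(T ^ n) v‖ ≤ (2 * n + 1) * ‖v‖) {u e : ℕ → V} {C : ℝ}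
    (he : ∀ n, ‖e n‖ ≤ C) (hu : ∀ n, u (n + 1) = T (u n) - e n) (n : ℕ) :
    ‖u n‖ ≤ (2 * n + 1) * (‖u 0‖ + n * C) := by
  suffices h : ∀ m, ‖(T ^ m) (u n)‖ ≤ (2 * (m + n : ℕ) + 1) * (‖u 0‖ + n * C) by simpa using h 0
  induction n with
  | zero => simpa using fun m => hT m (u 0)
  | succ n ih =>
    intro m
    have hC : 0 ≤ C := (norm_nonneg _).trans (he 0)
    have hTe : ‖(T ^ m) (e n)‖ ≤ (2 * m + 1) * C :=
      (hT m _).trans (mul_le_mul_of_nonneg_left (he n) (by positivity))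
    calc ‖(T ^ m) (u (n + 1))‖ = ‖(T ^ (m + 1)) (u n) - (T ^ m) (e n)‖ := by
          rw [hu, map_sub, pow_succ]; rfl
      _ ≤ (2 * (m + 1 + n : ℕ) + 1) * (‖u 0‖ + n * C) + (2 * m + 1) * C :=
          norm_sub_le_of_le (ih (m + 1)) hTe
      _ ≤ (2 * (m + (n + 1) : ℕ) + 1) * (‖u 0‖ + (n + 1 : ℕ) * C) := by
          push_cast
          nlinarith [mul_nonneg (Nat.cast_nonneg (α := ℝ) n) hC]

section NeumannSeries

variable {A B X : Type*} [NonUnitalCStarAlgebra A] [PartialOrder A] [StarOrderedRing A]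
  [NonUnitalCStarAlgebra B] [NormedAddCommGroup X] [NormedSpace ℂ X] [SMul Aᵐᵒᵖ X]
  [CStarModule Aᵐᵒᵖ X] [CompleteSpace X] {𝒜 : NonUnitalStarSubalgebra ℂ A}
  {ρ : A →⋆ₙₐ[ℂ] B} {δ : 𝒜 →ₗ[ℂ] B} (hδ : IsDerivationAlong ρ δ)
  {w : ℕ → ℝ} (hw : IsWeight w) {η : ℕ → X} (hη : ∀ i, ‖η i‖ ≤ 1)
  {D₀ : ℕ × ℕ →ᵇ B} (hD₀ : (1, D₀) ∈ derivGraph (X := X) δ η)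
include hδ hw hη hD₀

theorem exists_neg_frameOp_pow_mem_derivGraph (n : ℕ) :
    ∃ D, ((-frameOp A (weighted w η)) ^ n, D) ∈ derivGraph δ η ∧
      ‖D‖ ≤ (n + 1) * (∑' i, w i ^ 2) ^ n * ‖D₀‖ := by
  set h := frameOp A (weighted w η)
  set κ := ∑' i, w i ^ 2
  have : 0 ≤ κ := tsum_nonneg fun _ => sq_nonneg _
  have hpow : ∀ n, ‖(-h) ^ n‖ ≤ κ ^ n
    | 0 => ContinuousLinearMap.norm_id_le
    | n + 1 => (norm_pow_le' _ n.succ_pos).trans <| pow_le_pow_left₀ (norm_nonneg _)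
        ((norm_neg h).trans_le (norm_frameOp_weighted_le hw hη)) _
  induction n with
  | zero => exact ⟨D₀, hD₀, by simp⟩
  | succ n ih =>
    obtain ⟨D, hD, hle⟩ := ih
    refine ⟨-(weightedMul hw D₀ (coeffMat ρ hη ((-h) ^ n)) +
      weightedMul hw (coeffMat ρ hη 1) D), ?_, ?_⟩
    · have hmem := neg_mem (mul_frameOp_mul_mem_derivGraph hδ hw hη .one hD₀ hD)
      rwa [one_mul, Prod.neg_mk, ← neg_mul, ← pow_succ'] at hmem
    · rw [norm_neg]
      have hone : ‖(1 : X →L[ℂ] X)‖ ≤ 1 := ContinuousLinearMap.norm_id_le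
      calc _ ≤ κ * (‖D₀‖ * ‖(-h) ^ n‖ + ‖(1 : X →L[ℂ] X)‖ * ‖D‖) :=
            norm_weightedMul_add_le ρ hw hη _ _ _ _
        _ ≤ κ * (‖D₀‖ * κ ^ n + 1 * ((n + 1) * κ ^ n * ‖D₀‖)) := by
            gcongr
            exact hpow n
        _ = ((n + 1 : ℕ) + 1) * κ ^ (n + 1) * ‖D₀‖ := by push_cast; ring

theorem exists_one_add_cayley_mem_derivGraph :
    ∃ E, (1 + cayley (frameOp A (weighted w η)), E) ∈ derivGraph δ η := by
  choose D hD hle using exists_neg_frameOp_pow_mem_derivGraph hδ hw hη hD₀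
  have hκ : ‖∑' i, w i ^ 2‖ < 1 := by
    rw [Real.norm_of_nonneg (tsum_nonneg fun _ => sq_nonneg _)]
    exact hw.tsum_sq_lt_one
  have hgeom : Summable fun n : ℕ => ((n : ℝ) + 1) * (∑' i, w i ^ 2) ^ n := by
    simpa [add_mul] using (summable_pow_mul_geometric_of_norm_lt_one 1 hκ).add
      (summable_geometric_of_norm_lt_one hκ)
  have hsum : Summable D := .of_norm_bounded (hgeom.mul_right ‖D₀‖) hle
  have hcayley := hasSum_one_add_cayley
    ((isSmallFamily_weighted hw hη).norm_frameOp_lt_one (A := A))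
  refine ⟨(2 : ℂ) • ∑' n, D n, (isClosed_derivGraph δ η).mem_of_tendsto
    (hcayley.prodMk (hsum.hasSum.const_smul (2 : ℂ)))
    (Eventually.of_forall fun s => sum_mem fun n _ => ?_)⟩
  have hmem := (derivGraph δ η).smul_mem (2 : ℂ) (hD n)
  rwa [Prod.smul_mk, two_smul ℂ (_ ^ n), ← two_mul] at hmem

end NeumannSeries

section RightMultiplication

variable {A B X : Type*} [NonUnitalCStarAlgebra A] [PartialOrder A] [StarOrderedRing A]
  [NonUnitalCStarAlgebra B] [NormedAddCommGroup X] [NormedSpace ℂ X] [SMul Aᵐᵒᵖ X]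
  [CStarModule Aᵐᵒᵖ X] (ρ : A →⋆ₙₐ[ℂ] B) {w : ℕ → ℝ} (hw : IsWeight w)
  {η : ℕ → X} (hη : ∀ i, ‖η i‖ ≤ 1)

/-- The operator `F ↦ F - F ⋆ c(1 + r)` on bounded matrices, where `c` is `coeffMat` and `r` is the
Cayley transform of the frame operator `h`. Since `1 - h (1 + r) = r`, it is multiplication by `r`
from the right in terms of matrix coefficients. -/
noncomputable def rightCayley : (ℕ × ℕ →ᵇ B) →L[ℂ] (ℕ × ℕ →ᵇ B) :=
  1 - (weightedMul hw).flip (coeffMat ρ hη (1 + cayley (frameOp A (weighted w η))))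

theorem rightCayley_apply (F : ℕ × ℕ →ᵇ B) : rightCayley ρ hw hη F =
    F - weightedMul hw F (coeffMat ρ hη (1 + cayley (frameOp A (weighted w η)))) := rfl

variable [CompleteSpace X]

theorem rightCayley_pow_apply (n : ℕ) (F : ℕ × ℕ →ᵇ B) :
    (rightCayley ρ hw hη ^ n) F = F - weightedMul hw F (coeffMat ρ hη
      ((1 + cayley (frameOp A (weighted w η))) *
        ∑ k ∈ Finset.range n, cayley (frameOp A (weighted w η)) ^ k)) := by
  have hξ := isSmallFamily_weighted hw hη
  have hlt := hξ.norm_frameOp_lt_one (A := A)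
  have hadj := hξ.isPositiveOp_frameOp.isAdjoint_one_add_cayley (A := A) hlt
  have hqh := mul_one_add_cayley hlt
  rw [((Commute.one_right _).add_right (commute_cayley _)).eq] at hqh
  have hqr : Commute (1 + cayley (frameOp A (weighted w η))) (cayley (frameOp A (weighted w η))) :=
    (Commute.one_left _).add_left (.refl _)
  have hmul := coeffMat_mul_frameOp_mul ρ hw hη hadj
  induction n generalizing F with
  | zero => simp
  | succ n ih =>
    set r := cayley (frameOp A (weighted w η))
    set S := ∑ k ∈ Finset.range n, r ^ k
    have hS : (1 + r) * (r * S + 1) =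
        (1 + r) * S + (1 + r) - (1 + r) * frameOp A (weighted w η) * ((1 + r) * S) := by
      rw [hqh, mul_add, ← mul_assoc, hqr.eq]
      noncomm_ring
    have hc : coeffMat ρ hη ((1 + r) * (r * S + 1)) =
        coeffMat ρ hη ((1 + r) * S) + coeffMat ρ hη (1 + r) -
          weightedMul hw (coeffMat ρ hη (1 + r)) (coeffMat ρ hη ((1 + r) * S)) := by
      rw [hS, map_sub, map_add (coeffMat ρ hη) ((1 + r) * S), hmul]
    rw [pow_succ, mul_apply_eq_comp, ih, geom_sum_succ, hc, rightCayley_apply]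
    generalize coeffMat ρ hη (1 + r) = G
    simp only [map_sub, map_add, sub_apply, weightedMul_assoc]
    abel

theorem norm_rightCayley_pow_apply_le (n : ℕ) (F : ℕ × ℕ →ᵇ B) :
    ‖(rightCayley ρ hw hη ^ n) F‖ ≤ (2 * n + 1) * ‖F‖ := by
  have hξ := isSmallFamily_weighted hw hη
  have hlt := hξ.norm_frameOp_lt_one (A := A)
  have hpos := hξ.isPositiveOp_frameOp (A := A)
  rw [rightCayley_pow_apply]
  set r := cayley (frameOp A (weighted w η))
  have hgeom : ‖∑ k ∈ Finset.range n, r ^ k‖ ≤ n := by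
    simpa using norm_sum_le_of_le (Finset.range n) fun k _ => hpos.norm_cayley_pow_le hlt k
  calc _ ≤ ‖F‖ + ‖F‖ * (2 * n) := norm_sub_le_of_le le_rfl <|
        (norm_weightedMul_le_mul hw _ _).trans <| mul_le_mul_of_nonneg_left
          ((norm_coeffMat_le ρ hη _).trans <| (norm_mul_le _ _).trans <|
            mul_le_mul (hpos.norm_one_add_cayley_le hlt) hgeom (norm_nonneg _) zero_le_two)
          (norm_nonneg _)
    _ = (2 * n + 1) * ‖F‖ := by ring

end RightMultiplication

section Growth

variable {A B X : Type*} [NonUnitalCStarAlgebra A] [PartialOrder A] [StarOrderedRing A]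
  [NonUnitalCStarAlgebra B] [NormedAddCommGroup X] [NormedSpace ℂ X] [SMul Aᵐᵒᵖ X]
  [CStarModule Aᵐᵒᵖ X] [CompleteSpace X] {𝒜 : NonUnitalStarSubalgebra ℂ A}
  {ρ : A →⋆ₙₐ[ℂ] B} {δ : 𝒜 →ₗ[ℂ] B} (hδ : IsDerivationAlong ρ δ)
  {w : ℕ → ℝ} (hw : IsWeight w) {η : ℕ → X} (hη : ∀ i, ‖η i‖ ≤ 1)
  {D₀ : ℕ × ℕ →ᵇ B} (hD₀ : (1, D₀) ∈ derivGraph (X := X) δ η)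
include hδ hw hη hD₀

theorem exists_cayley_pow_mem_derivGraph : ∃ C, ∀ n : ℕ, ∃ D,
    (cayley (frameOp A (weighted w η)) ^ n, D) ∈ derivGraph δ η ∧ ‖D‖ ≤ C * (n + 1) ^ 2 := by
  obtain ⟨E, hE⟩ := exists_one_add_cayley_mem_derivGraph hδ hw hη hD₀
  have hξ := isSmallFamily_weighted hw hη
  have hlt := hξ.norm_frameOp_lt_one (A := A)
  have hpos := hξ.isPositiveOp_frameOp (A := A)
  have hadj := hpos.isAdjoint_cayley hlt
  have hhq := mul_one_add_cayley hlt
  set r := cayley (frameOp A (weighted w η))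
  let D : ℕ → ℕ × ℕ →ᵇ B := fun n => n.rec D₀ fun n F =>
    rightCayley ρ hw hη F - weightedMul hw (coeffMat ρ hη (r ^ n)) E
  have hD (n : ℕ) : (r ^ n, D n) ∈ derivGraph δ η := by
    induction n with
    | zero => exact hD₀
    | succ n ih =>
      have hmem := sub_mem ih (mul_frameOp_mul_mem_derivGraph hδ hw hη (hadj.pow n) ih hE)
      rw [Prod.mk_sub_mk, mul_assoc, hhq, mul_sub, mul_one, sub_sub_cancel, ← pow_succ,
        ← sub_sub] at hmem
      exact hmem
  have he (n : ℕ) : ‖weightedMul hw (coeffMat ρ hη (r ^ n)) E‖ ≤ ‖E‖ :=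
    (norm_weightedMul_le_mul hw _ _).trans <| mul_le_of_le_one_left (norm_nonneg _) <|
      (norm_coeffMat_le ρ hη _).trans (hpos.norm_cayley_pow_le hlt n)
  refine ⟨2 * (‖D₀‖ + ‖E‖), fun n => ⟨D n, hD n, ?_⟩⟩
  calc ‖D n‖ ≤ (2 * n + 1) * (‖D₀‖ + n * ‖E‖) :=
        norm_le_of_recurrence (norm_rightCayley_pow_apply_le ρ hw hη) he (fun _ => rfl) n
    _ ≤ (2 * (n + 1)) * ((n + 1) * (‖D₀‖ + ‖E‖)) := by
        gcongr <;> nlinarith [norm_nonneg D₀, norm_nonneg E, Nat.cast_nonneg (α := ℝ) n]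
    _ = 2 * (‖D₀‖ + ‖E‖) * (n + 1) ^ 2 := by ring

theorem exists_frameOp_pow_mul_cayley_pow_mem_derivGraph (p : ℕ) : ∃ C, ∀ n : ℕ, ∃ D,
    (frameOp A (weighted w η) ^ p * cayley (frameOp A (weighted w η)) ^ n, D) ∈ derivGraph δ η ∧
      ‖D‖ ≤ C * (n + 1) ^ 2 := by
  have hξ := isSmallFamily_weighted hw hη
  induction p with
  | zero => simpa using exists_cayley_pow_mem_derivGraph hδ hw hη hD₀
  | succ p ih =>
    obtain ⟨C, hC⟩ := ih
    refine ⟨‖D₀‖ + C, fun n => ?_⟩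
    obtain ⟨D, hD, hle⟩ := hC n
    have hmem := mul_frameOp_mul_mem_derivGraph hδ hw hη .one hD₀ hD
    rw [one_mul, ← mul_assoc, ← pow_succ'] at hmem
    refine ⟨_, hmem, ?_⟩
    have hone : ‖(1 : X →L[ℂ] X)‖ ≤ 1 := ContinuousLinearMap.norm_id_le
    have hn : (1 : ℝ) ≤ (n + 1 : ℝ) ^ 2 := one_le_pow₀ (by simp)
    calc _ ≤ ‖D₀‖ * 1 + 1 * (C * (n + 1) ^ 2) :=
          (norm_weightedMul_add_le_add ρ hw hη _ _ _ _).trans <| add_le_add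
            (mul_le_mul_of_nonneg_left (hξ.norm_frameOp_pow_mul_cayley_pow_le p n) (norm_nonneg _))
            (mul_le_mul hone hle (norm_nonneg _) zero_le_one)
      _ ≤ (‖D₀‖ + C) * (n + 1) ^ 2 := by nlinarith [norm_nonneg D₀]

end Growth

theorem IsWeight.summable_unpair {w : ℕ → ℝ} (hw : IsWeight w) :
    Summable fun n : ℕ => w n.unpair.1 * (1 / (n.unpair.2 + 1 : ℝ) ^ 2) := by
  have hsq : Summable fun k : ℕ => 1 / (k + 1 : ℝ) ^ 2 := by
    simpa using (summable_nat_add_iff 1).2 (Real.summable_one_div_nat_pow.2 one_lt_two)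
  have hprod := hw.summable.mul_of_nonneg hsq (fun i => (hw.pos i).le) fun _ => by positivity
  simpa [Function.comp_def] using Nat.pairEquiv.symm.summable_iff.2 hprod

theorem IsWeight.summable_norm_smul_unpair {V : Type*} [NormedAddCommGroup V] [NormedSpace ℂ V]
    {w : ℕ → ℝ} (hw : IsWeight w) {F : ℕ → ℕ → ℕ → V} {C : ℝ}
    (hF : ∀ N i j, ‖F N i j‖ * (N + 1) ^ 4 ≤ C) :
    Summable fun p : ℕ × ℕ => ‖(w p.2.unpair.1 * w p.1.unpair.1 : ℂ) •
      F (p.1.unpair.2 + p.2.unpair.2) p.1.unpair.1 p.2.unpair.1‖ := by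
  let f : ℕ → ℝ := fun n => w n.unpair.1 * (1 / (n.unpair.2 + 1 : ℝ) ^ 2)
  have hf0 (n : ℕ) : 0 ≤ f n := mul_nonneg (hw.pos _).le (by positivity)
  have hf : Summable f := hw.summable_unpair
  refine .of_nonneg_of_le (fun _ => norm_nonneg _) (fun p => ?_)
    ((hf.mul_of_nonneg hf hf0 hf0).mul_left C)
  obtain ⟨m, n⟩ := p
  set i := m.unpair.1
  set k := m.unpair.2
  set j := n.unpair.1
  set l := n.unpair.2
  have hkl : ((k + 1 : ℝ) * (l + 1)) ^ 2 ≤ ((k + l : ℕ) + 1 : ℝ) ^ 4 := by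
    calc ((k + 1 : ℝ) * (l + 1)) ^ 2 ≤ (((k + l : ℕ) + 1 : ℝ) ^ 2) ^ 2 := by
          gcongr
          push_cast
          nlinarith [Nat.cast_nonneg (α := ℝ) k, Nat.cast_nonneg (α := ℝ) l]
      _ = _ := by ring
  have hle : ‖F (k + l) i j‖ ≤ C / ((k + 1 : ℝ) * (l + 1)) ^ 2 :=
    (le_div_iff₀ (by positivity)).2 <|
      (mul_le_mul_of_nonneg_left hkl (norm_nonneg _)).trans (hF (k + l) i j)
  rw [norm_smul, norm_mul, Complex.norm_real, Complex.norm_real,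
    Real.norm_of_nonneg (hw.pos j).le, Real.norm_of_nonneg (hw.pos i).le]
  calc w j * w i * ‖F (k + l) i j‖ ≤ w j * w i * (C / ((k + 1 : ℝ) * (l + 1)) ^ 2) :=
        mul_le_mul_of_nonneg_left hle (mul_pos (hw.pos j) (hw.pos i)).le
    _ = C * (f m * f n) := by
        simp only [f, mul_pow, div_eq_mul_inv, mul_inv]
        ring

theorem norm_sub_mul_pow_le_of_decay {V : Type*} [SeminormedAddCommGroup V] {u : ℕ → V} {C : ℝ}
    (hu : ∀ N : ℕ, ‖u N‖ * (N + 1) ^ 4 ≤ C) (N : ℕ) : ‖u N - u (N + 2)‖ * (N + 1) ^ 4 ≤ 2 * C := by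
  have hle : ‖u (N + 2)‖ * (N + 1) ^ 4 ≤ C := (hu (N + 2)).trans' (by gcongr; simp)
  calc ‖u N - u (N + 2)‖ * (N + 1) ^ 4 ≤ (‖u N‖ + ‖u (N + 2)‖) * (N + 1) ^ 4 := by
        gcongr
        exact norm_sub_le _ _
    _ ≤ 2 * C := by linarith [hu N]

theorem add_mul_pow_le_of_decay {a b : ℕ} (hab : a ≤ b) (hba : b ≤ a + 1) {u v x y C M : ℝ}
    (hC : 0 ≤ C) (hx₀ : 0 ≤ x) (hy₀ : 0 ≤ y) (hu : u ≤ C * (a + 1) ^ 2) (hv : v ≤ C * (b + 1) ^ 2)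
    (hx : x * (a + 1) ^ 6 ≤ M) (hy : y * (b + 1) ^ 6 ≤ M) :
    (u * y + x * v) * ((a + b : ℕ) + 1) ^ 4 ≤ 80 * C * M := by
  have hab' : (a + 1 : ℝ) ≤ b + 1 := by exact_mod_cast Nat.succ_le_succ hab
  have hba' : (b : ℝ) + 1 ≤ 2 * (a + 1) := by exact_mod_cast (by omega : b + 1 ≤ 2 * (a + 1))
  have hN : ((a + b : ℕ) : ℝ) + 1 ≤ 2 * (a + 1) := by
    exact_mod_cast (by omega : a + b + 1 ≤ 2 * (a + 1))
  have hv' : v ≤ C * (2 * (a + 1)) ^ 2 := hv.trans (by gcongr)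
  have hy' : y * (a + 1) ^ 6 ≤ M := (by gcongr : _ ≤ y * (b + 1 : ℝ) ^ 6).trans hy
  calc (u * y + x * v) * ((a + b : ℕ) + 1) ^ 4
      ≤ (C * (a + 1) ^ 2 * y + x * (C * (2 * (a + 1)) ^ 2)) * (2 * (a + 1)) ^ 4 := by gcongr
    _ = 16 * C * (y * (a + 1) ^ 6) + 64 * C * (x * (a + 1) ^ 6) := by ring
    _ ≤ 16 * C * M + 64 * C * M := by gcongr
    _ = 80 * C * M := by ring

section Entries

variable {A B X : Type*} [NonUnitalCStarAlgebra A] [PartialOrder A] [StarOrderedRing A]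
  [NonUnitalCStarAlgebra B] [NormedAddCommGroup X] [NormedSpace ℂ X] [SMul Aᵐᵒᵖ X]
  [CStarModule Aᵐᵒᵖ X] [CompleteSpace X] {𝒜 : NonUnitalStarSubalgebra ℂ A}
  {ρ : A →⋆ₙₐ[ℂ] B} {δ : 𝒜 →ₗ[ℂ] B} (hδ : IsDerivationAlong ρ δ)
  {w : ℕ → ℝ} (hw : IsWeight w) {η : ℕ → X} (hη : ∀ i, ‖η i‖ ≤ 1)
  {D₀ : ℕ × ℕ →ᵇ B} (hD₀ : (1, D₀) ∈ derivGraph (X := X) δ η)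
include hδ hw hη hD₀

theorem exists_norm_mul_pow_le_of_mem_derivGraph : ∃ C, ∀ N : ℕ, ∃ D,
    (frameOp A (weighted w η) ^ 25 * cayley (frameOp A (weighted w η)) ^ N, D)
      ∈ derivGraph δ η ∧ ‖D‖ * (N + 1) ^ 4 ≤ C := by
  obtain ⟨C, hC⟩ := exists_frameOp_pow_mul_cayley_pow_mem_derivGraph hδ hw hη hD₀ 12
  choose D hD hDle using hC
  have hC0 : 0 ≤ C := by simpa using (norm_nonneg _).trans (hDle 0)
  have hξ := isSmallFamily_weighted hw hη
  have hpos := hξ.isPositiveOp_frameOp (A := A)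
  have hradj := hpos.isAdjoint_cayley hξ.norm_frameOp_lt_one
  have hcomm := commute_cayley (frameOp A (weighted w η))
  have hdecay := hξ.norm_frameOp_pow_mul_cayley_pow_mul_le (A := A) (m := 6) (by norm_num)
  set h := frameOp A (weighted w η)
  set r := cayley h
  refine ⟨80 * C * (2 * (6 : ℕ)) ^ 6, fun N => ?_⟩
  obtain ⟨a, b, rfl, hab, hba⟩ : ∃ a b, N = a + b ∧ a ≤ b ∧ b ≤ a + 1 :=
    ⟨N / 2, N - N / 2, by omega, by omega, by omega⟩
  have hmem := mul_frameOp_mul_mem_derivGraph hδ hw hη ((hpos.1.pow 12).mul (hradj.pow a))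
    (hD a) (hD b)
  have hfactor : h ^ 12 * r ^ a * h * (h ^ 12 * r ^ b) = h ^ 25 * r ^ (a + b) := by
    rw [mul_assoc (h ^ 12), ← (hcomm.pow_right a).eq, mul_assoc, mul_assoc,
      ← mul_assoc (r ^ a), ← (hcomm.pow_pow 12 a).eq]
    simp only [← mul_assoc, ← pow_add, ← pow_succ]
    simp only [mul_assoc, ← pow_add]
  rw [hfactor] at hmem
  exact ⟨_, hmem, (mul_le_mul_of_nonneg_right
    (norm_weightedMul_add_le_add ρ hw hη _ _ _ _) (by positivity)).trans <|
      add_mul_pow_le_of_decay hab hba hC0 (norm_nonneg _) (norm_nonneg _) (hDle a) (hDle b)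
        (hdecay a) (hdecay b)⟩

end Entries

namespace IsSmallFamily

variable {A X : Type*} [NonUnitalCStarAlgebra A] [PartialOrder A] [StarOrderedRing A]
  [NormedAddCommGroup X] [NormedSpace ℂ X] [SMul Aᵐᵒᵖ X] [CStarModule Aᵐᵒᵖ X] [CompleteSpace X]
  {ξ : ℕ → X} (hξ : IsSmallFamily ξ)
include hξ

theorem norm_frameOp_pow_add_mul_cayley_pow_mul_le {m : ℕ} (hm : 0 < m) (p N : ℕ) :
    ‖frameOp A ξ ^ (p + 2 * m) * cayley (frameOp A ξ) ^ N‖ * (N + 1) ^ m ≤ (2 * m) ^ m := by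
  refine (mul_le_mul_of_nonneg_right ?_ (by positivity)).trans
    (hξ.norm_frameOp_pow_mul_cayley_pow_mul_le (A := A) hm N)
  rw [pow_add, mul_assoc]
  exact (norm_mul_le _ _).trans
    (mul_le_of_le_one_left (norm_nonneg _) (hξ.norm_frameOp_pow_le_one p))

theorem rinner_one_add_cayley_frameOp_pow (n k l : ℕ) (x y : X) :
    rinner A ((1 + cayley (frameOp A ξ)) ((cayley (frameOp A ξ) ^ k) x))
        ((frameOp A ξ ^ (n + 1)) ((1 + cayley (frameOp A ξ)) ((cayley (frameOp A ξ) ^ l) y))) =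
      rinner A x ((frameOp A ξ ^ n * cayley (frameOp A ξ) ^ (k + l) -
        frameOp A ξ ^ n * cayley (frameOp A ξ) ^ (k + l + 2)) y) := by
  have hlt := hξ.norm_frameOp_lt_one (A := A)
  have hpos := hξ.isPositiveOp_frameOp (A := A)
  have hradj := hpos.isAdjoint_cayley hlt
  have hqadj := hpos.isAdjoint_one_add_cayley hlt
  have hqhq := one_add_cayley_mul_mul_one_add_cayley hlt
  have hcomm := commute_cayley (frameOp A ξ)
  set h := frameOp A ξ
  set r := cayley h
  have hqh : Commute (1 + r) h := (Commute.one_left _).add_left hcomm.symm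
  have hfactor : r ^ k * (1 + r) * h ^ (n + 1) * ((1 + r) * r ^ l) =
      h ^ n * r ^ (k + l) - h ^ n * r ^ (k + l + 2) := by
    calc _ = r ^ k * h ^ n * ((1 + r) * h * (1 + r)) * r ^ l := by
          rw [pow_succ, mul_assoc (r ^ k), ← mul_assoc (1 + r), (hqh.pow_right n).eq]
          simp only [mul_assoc]
      _ = h ^ n * (r ^ k * (1 - r ^ 2) * r ^ l) := by
          rw [hqhq, (hcomm.pow_pow n k).eq.symm]
          simp only [mul_assoc]
      _ = _ := by
          rw [← mul_sub, mul_sub, sub_mul, mul_one, ← pow_add, ← pow_add, ← pow_add,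
            add_right_comm k 2 l]
  rw [← hfactor, hqadj, hradj.pow k]
  rfl

end IsSmallFamily

section Main

variable {A B X : Type*} [NonUnitalCStarAlgebra A] [PartialOrder A] [StarOrderedRing A]
  [NonUnitalCStarAlgebra B] [PartialOrder B] [StarOrderedRing B]
  [NormedAddCommGroup X] [NormedSpace ℂ X] [SMul Aᵐᵒᵖ X]
  [CStarModule Aᵐᵒᵖ X] [CompleteSpace X] {𝒜 : NonUnitalStarSubalgebra ℂ A}
  {ρ : A →⋆ₙₐ[ℂ] B} {δ : 𝒜 →ₗ[ℂ] B} (hδ : IsDerivationAlong ρ δ)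
  {w : ℕ → ℝ} (hw : IsWeight w) {η : ℕ → X} (hη : ∀ i, ‖η i‖ ≤ 1)
  {D₀ : ℕ × ℕ →ᵇ B} (hD₀ : (1, D₀) ∈ derivGraph (X := X) δ η)
include hδ hw hη hD₀

theorem conj_frameOp_pow_mem_diffCompactOps
    (hF : IsParsevalFrame A fun n => (1 + cayley (frameOp A (weighted w η)))
      ((cayley (frameOp A (weighted w η)) ^ n.unpair.2) (weighted w η n.unpair.1))) :
    hF.conj (frameOp A (weighted w η) ^ 26) ∈ diffCompactOps δ := by
  obtain ⟨C, hC⟩ := exists_norm_mul_pow_le_of_mem_derivGraph hδ hw hη hD₀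
  choose D hD hDle using hC
  have hξ := isSmallFamily_weighted hw hη
  have hadj := (hξ.isPositiveOp_frameOp (A := A)).1.pow 26
  have hentry := hξ.rinner_one_add_cayley_frameOp_pow (A := A) 25
  have hdecay := hξ.norm_frameOp_pow_add_mul_cayley_pow_mul_le (A := A) (m := 4) (by norm_num) 17
  let h := frameOp A (weighted w η)
  let r := cayley h
  let Q (N : ℕ) : X →L[ℂ] X := h ^ 25 * r ^ N - h ^ 25 * r ^ (N + 2)
  have hQ (N i j : ℕ) : ‖rinner A (η i) (Q N (η j))‖ * (N + 1) ^ 4 ≤ 2 * (2 * (4 : ℕ)) ^ 4 :=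
    (mul_le_mul_of_nonneg_right (norm_rinner_apply_le hη _ i j) (by positivity)).trans
      (norm_sub_mul_pow_le_of_decay hdecay N)
  have hDQ (N i j : ℕ) : ‖(D N - D (N + 2)) (i, j)‖ * (N + 1) ^ 4 ≤ 2 * C :=
    (mul_le_mul_of_nonneg_right ((D N - D (N + 2)).norm_coe_le_norm (i, j)) (by positivity)).trans
      (norm_sub_mul_pow_le_of_decay hDle N)
  refine mem_diffCompactOps_of_summable
    (a := fun m n => (w n.unpair.1 * w m.unpair.1 : ℂ) •
      rinner A (η m.unpair.1) (Q (m.unpair.2 + n.unpair.2) (η n.unpair.1)))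
    (b := fun m n => (w n.unpair.1 * w m.unpair.1 : ℂ) •
      (D (m.unpair.2 + n.unpair.2) - D (m.unpair.2 + n.unpair.2 + 2)) (m.unpair.1, n.unpair.1))
    (fun m n => ?_)
    (hw.summable_norm_smul_unpair (F := fun N i j => rinner A (η i) (Q N (η j))) hQ)
    (hw.summable_norm_smul_unpair (F := fun N i j => (D N - D (N + 2)) (i, j)) hDQ) fun x m => ?_
  · exact (graphClosure δ).smul_mem (w n.unpair.1 * w m.unpair.1 : ℂ)
      (mem_derivGraph.1 (sub_mem (hD _) (hD _)) m.unpair.1 n.unpair.1)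
  · have hsum := hF.hasSum_conj_apply hadj x m
    simp only [hentry] at hsum
    refine hsum.congr_fun fun n => ?_
    simp only [weighted, map_smul, rinner_smul_complex_left, rinner_smul_complex_right, smul_smul,
      Complex.star_def, Complex.conj_ofReal, Q, h, r]

end Main

section Rescaling

theorem exists_pos_mul_le_one {u : ℕ → ℝ} (hu : ∀ i, 0 ≤ u i) {d : ℕ → ℕ → ℝ}
    (hd : ∀ i j, 0 ≤ d i j) :
    ∃ c : ℕ → ℝ, (∀ i, 0 < c i) ∧ (∀ i, c i * u i ≤ 1) ∧ ∀ i j, c i * c j * d i j ≤ 1 := by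
  let s : ℕ → ℝ := fun l => ∑ p ∈ Finset.range (l + 1) ×ˢ Finset.range (l + 1), d p.1 p.2
  have hs (l : ℕ) : 0 ≤ s l := Finset.sum_nonneg fun p _ => hd p.1 p.2
  have hds {i j l : ℕ} (hi : i ≤ l) (hj : j ≤ l) : d i j ≤ s l :=
    Finset.single_le_sum (f := fun p : ℕ × ℕ => d p.1 p.2) (a := (i, j)) (fun p _ => hd p.1 p.2)
      (Finset.mem_product.2 ⟨Finset.mem_range_succ_iff.2 hi, Finset.mem_range_succ_iff.2 hj⟩)
  let c : ℕ → ℝ := fun l => (1 + u l + s l)⁻¹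
  have hpos (l : ℕ) : 0 < 1 + u l + s l := by linarith [hu l, hs l]
  have hc (l : ℕ) : 0 < c l := inv_pos.2 (hpos l)
  have hc1 (l : ℕ) : c l ≤ 1 := inv_le_one_of_one_le₀ (by linarith [hu l, hs l])
  have hcv {l : ℕ} {v : ℝ} (hv : v ≤ 1 + u l + s l) : c l * v ≤ 1 :=
    (inv_mul_le_one₀ (hpos l)).2 hv
  refine ⟨c, hc, fun i => hcv (by linarith [hs i]), fun i j => ?_⟩
  rcases le_total i j with hij | hij
  · rw [mul_assoc]
    exact mul_le_one₀ (hc1 i) (mul_nonneg (hc j).le (hd i j))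
      (hcv (by linarith [hds hij le_rfl, hu j]))
  · rw [mul_right_comm]
    exact mul_le_one₀ (hcv (by linarith [hds le_rfl hij, hu i])) (hc j).le (hc1 j)

variable {A B X : Type*} [NonUnitalCStarAlgebra A] [PartialOrder A]
  [NormedAddCommGroup X] [NormedSpace ℂ X] [SMul Aᵐᵒᵖ X] [CStarModule Aᵐᵒᵖ X]

theorem rightSpan_subset_rightSpan_weighted {c : ℕ → ℝ} (hc : ∀ i, c i ≠ 0) (ξ : ℕ → X) :
    rightSpan A ξ ⊆ rightSpan A (weighted c ξ) := by
  rintro _ ⟨N, a, rfl⟩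
  refine ⟨N, fun n => (c n : ℂ)⁻¹ • a n, Finset.sum_congr rfl fun n _ => ext_rinner (A := A)
    fun z => ?_⟩
  rw [weighted, rinner_smul_right, rinner_smul_right, rinner_smul_complex_right,
    smul_mul_smul_comm, mul_inv_cancel₀ (Complex.ofReal_ne_zero.2 (hc n)), one_smul]

theorem exists_weighted_mem_derivGraph [StarOrderedRing A] [NonUnitalCStarAlgebra B]
    {𝒜 : NonUnitalStarSubalgebra ℂ A} (δ : 𝒜 →ₗ[ℂ] B) {ξ : ℕ → X}
    (hξ : ∀ n m, rinner A (ξ n) (ξ m) ∈ 𝒜) :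
    ∃ c : ℕ → ℝ, (∀ i, 0 < c i) ∧ (∀ i, ‖weighted c ξ i‖ ≤ 1) ∧
      ∃ D₀, (1, D₀) ∈ derivGraph (X := X) δ (weighted c ξ) := by
  obtain ⟨c, hc, hcξ, hcδ⟩ := exists_pos_mul_le_one (fun i => norm_nonneg (ξ i))
    (fun i j => norm_nonneg (δ ⟨_, hξ i j⟩))
  refine ⟨c, hc, fun i => ?_, BoundedContinuousFunction.ofNormedAddCommGroupDiscrete
    (fun p => (c p.2 * c p.1 : ℂ) • δ ⟨_, hξ p.1 p.2⟩) 1 fun p => ?_,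
    mem_derivGraph.2 fun i j => ?_⟩
  · rw [weighted, norm_smul, Complex.norm_real, Real.norm_of_nonneg (hc i).le]
    exact hcξ i
  · rw [norm_smul, norm_mul, Complex.norm_real, Complex.norm_real, Real.norm_of_nonneg (hc _).le,
      Real.norm_of_nonneg (hc _).le, mul_comm (c p.2)]
    exact hcδ _ _
  · have hmem := (graphClosure δ).smul_mem (c j * c i : ℂ) (mem_graphClosure δ ⟨_, hξ i j⟩)
    have hentry : rinner A (weighted c ξ i) ((1 : X →L[ℂ] X) (weighted c ξ j)) =
        (c j * c i : ℂ) • rinner A (ξ i) (ξ j) := by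
      simp only [one_apply_eq_self, weighted, rinner_smul_complex_left,
        rinner_smul_complex_right, smul_smul, Complex.star_def, Complex.conj_ofReal]
    rw [hentry]
    exact hmem

theorem isWeight_half_pow : IsWeight fun i => (1 / 2 : ℝ) ^ (i + 2) := by
  have hsum : HasSum (fun i => (1 / 2 : ℝ) ^ (i + 2)) (1 / 2) := by
    have h := hasSum_geometric_two.mul_right ((1 / 2 : ℝ) ^ 2)
    simp only [← pow_add] at h
    rwa [show (2 * (1 / 2) ^ 2 : ℝ) = 1 / 2 by norm_num] at h
  exact ⟨fun i => by positivity, hsum.summable, by rw [hsum.tsum_eq]; norm_num⟩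

end Rescaling

end DiffAbsorption

open DiffAbsorption in
theorem theoremt_general {A B X : Type*}
    [NonUnitalCStarAlgebra A] [PartialOrder A] [StarOrderedRing A]
    [NonUnitalCStarAlgebra B] [PartialOrder B] [StarOrderedRing B]
    [NormedAddCommGroup X] [NormedSpace ℂ X] [CompleteSpace X] [SMul Aᵐᵒᵖ X] [CStarModule Aᵐᵒᵖ X]
    (ρ : A →⋆ₙₐ[ℂ] B) (𝒜 : NonUnitalStarSubalgebra ℂ A) (δ : 𝒜 →ₗ[ℂ] B)
    (hδ : IsDerivationAlong ρ δ)
    (hX : ∃ ξ : ℕ → X, (∀ n m, rinner A (ξ n) (ξ m) ∈ 𝒜) ∧ Dense (rightSpan A ξ)) :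
    ∃ (W : X →L[ℂ] StdModule A) (W' : StdModule A →L[ℂ] X)
      (K : StdModule A →L[ℂ] StdModule A),
      IsAdjoint A W W' ∧
      (∀ x y, rinner A (W x) (W y) = rinner A x y) ∧
      IsPositiveOp A K ∧
      K ∘L (W ∘L W') = (W ∘L W') ∘L K ∧
      DenseRange (W' ∘L K ∘L W) ∧
      (W ∘L W') ∘L K ∈ compactOps A ∧
      (W ∘L W') ∘L (K ∘L K) ∈ diffCompactOps δ := by
  obtain ⟨ξ, hξ, hd⟩ := hX
  obtain ⟨c, hc, hη, D₀, hD₀⟩ := exists_weighted_mem_derivGraph δ hξ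
  obtain ⟨w, hw⟩ : ∃ w, IsWeight w := ⟨_, isWeight_half_pow⟩
  have hd' := (hd.mono (rightSpan_subset_rightSpan_weighted (fun i => (hc i).ne') ξ)).mono
    (rightSpan_subset_rightSpan_weighted (fun i => (hw.pos i).ne') _)
  have hsmall := isSmallFamily_weighted hw hη
  have hF := hsmall.isParsevalFrame hd'
  refine ⟨hF.analysis, hF.synthesis, hF.conj (frameOp A (weighted w (weighted c ξ)) ^ 13),
    hF.isAdjoint_analysis, hF.rinner_analysis,
    hF.isPositiveOp_conj (hsmall.isPositiveOp_frameOp.pow_odd 6), ?_, ?_, ?_, ?_⟩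
  · rw [hF.conj_comp_analysis_comp_synthesis, hF.analysis_comp_synthesis_comp_conj]
  · rw [hF.synthesis_comp_conj_comp_analysis]
    exact hsmall.denseRange_frameOp_pow hd' 13
  · rw [hF.analysis_comp_synthesis_comp_conj]
    exact hF.conj_mem_compactOps (hsmall.frameOp_pow_succ_mem_compactOps 12)
  · rw [hF.conj_comp_conj, hF.analysis_comp_synthesis_comp_conj, ← pow_add]
    exact conj_frameOp_pow_mem_diffCompactOps hδ hw hη hD₀ hF

open DiffAbsorption in
theorem theoremt {A B X : Type*}
    [NonUnitalCStarAlgebra A] [PartialOrder A] [StarOrderedRing A]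
    [NonUnitalCStarAlgebra B] [PartialOrder B] [StarOrderedRing B]
    [NormedAddCommGroup X] [NormedSpace ℂ X] [CompleteSpace X] [SMul Aᵐᵒᵖ X] [CStarModule Aᵐᵒᵖ X]
    (ρ : A →⋆ₙₐ[ℂ] B) (hρ : Function.Injective ρ)
    (𝒜 : NonUnitalStarSubalgebra ℂ A) (h𝒜 : Dense (𝒜 : Set A))
    (δ : 𝒜 →ₗ[ℂ] B) (hδ : IsClosedDerivation ρ δ)
    (hX : ∃ ξ : ℕ → X, (∀ n m, rinner A (ξ n) (ξ m) ∈ 𝒜) ∧ Dense (rightSpan A ξ)) :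
    ∃ (W : X →L[ℂ] StdModule A) (W' : StdModule A →L[ℂ] X)
      (K : StdModule A →L[ℂ] StdModule A),
      IsAdjoint A W W' ∧
      (∀ x y, rinner A (W x) (W y) = rinner A x y) ∧
      IsPositiveOp A K ∧
      K ∘L (W ∘L W') = (W ∘L W') ∘L K ∧
      DenseRange (W' ∘L K ∘L W) ∧
      (W ∘L W') ∘L K ∈ compactOps A ∧
      (W ∘L W') ∘L (K ∘L K) ∈ diffCompactOps δ :=
  theoremt_general ρ 𝒜 δ hδ.leibniz hX
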